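/- \textbf{Setting.} Fix $\ell>0$, $r_0\in(0,\ell/2)$, $e_0\neq 0$, $\gamma>0$, Lamé coefficients $\mu>0$, $\mu+\lambda>0$, a volume $d>0$, a finite (possibly empty) family $\mathbf B=\{\mathbf b_1,\dots,\mathbf b_k\}\subset\mathbb R^2$ of Burgers vectors, and a nonnegative, radially symmetric $\varrho\in C^\infty_c(B_1(0))$ with $\int_{\mathbb R^2}\varrho\,dz=1$; put $\varrho_{r_0}(z)=r_0^{-2}\varrho(z/r_0)$. \emph{Profiles.} $AP(0,\ell)$ is the set of lower semicontinuous $\ell$-periodic functions $h:\mathbb R\to[0,\infty)$ of finite pointwise total variation on $(0,\ell)$. With $h(x\pm)$ the one-sided limits, let $h^-(x)=\min\{h(x+),h(x-)\}$, $h^+(x)=\max\{h(x+),h(x-)\}$, and $$\Omega_h=\{(x,y): 0\le x<\ell,\ 0<y<h(x)\},\qquad \Omega_h^\#=\{(x,y): x\in\mathbb R,\ 0<y<h(x)\},$$ $$\Gamma_h=\{(x,y): 0\le x<\ell,\ h^-(x)\le y\le h^+(x)\},$$ $$\Sigma_h=\{(x,y): 0\le x<\ell,\ h(x)<h^-(x),\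 h(x)\le y\le h^-(x)\}\quad\text{(vertical cuts).}$$ \emph{Admissible triples.} $X(e_0;\mathbf B)$ is the set of triples $(h,\sigma,H)$ such that $h\in AP(0,\ell)$; $\sigma=\sum_{i=1}^k\mathbf b_i\sum_{m\in\mathbb Z}\delta_{z_i+m\ell\mathbf e_1}$ for some (not necessarily distinct) $z_i\in\Omega_h$ with $B_{r_0}(z_i)\subset\Omega_h^\#$; and $H:\Omega_h\to\mathbb R^{2\times2}$ is a field whose $\ell$-periodic extension $H^\#$ in $x$ is locally square integrable in $\Omega_h^\#$ up to the interface $\{y=0\}$ (that is, on $K\cap\Omega_h^\#$ for every compact $K\subset\{(x,y): y<h(x)\}$), with distributional curl $\operatorname{curl}H^\#\in L^2_{loc}(\Omega_h^\#;\mathbb R^2)$, $\operatorname{curl}H\in L^2(\Omega_h;\mathbb R^2)$, where $(\operatorname{curl} H)_i=\partial_xH_{i2}-\partial_yH_{i1}$, such that $\operatorname{curl}H^\#=\sigma*\varrho_{r_0}$ in $\Omega_h^\#$ and the tangential trace satisfies $H^\#[\mathbf e_1]=e_0\mathbf e_1$ on $\{y=0\}$ (in the sense of Green's formula tested with functions in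 $C^\infty_c(\{y<h(x)\})$). \emph{Energy.} With $H_{sym}=(H+H^T)/2$ and $W(E)=\mu|E|^2+\frac\lambda2(\operatorname{tr}E)^2$, let $$F(h,\sigma,H)=\int_{\Omega_h}W(H_{sym})\,dz+\gamma\,\mathcal H^1(\Gamma_h)+2\gamma\,\mathcal H^1(\Sigma_h)\in[0,\infty].$$ \textbf{Theorem.} Let $(\bar h,\bar\sigma,\bar H)\in X(e_0;\mathbf B)$ with $|\Omega_{\bar h}|=d$ be a minimizer of $F$ among all $(h,\sigma,H)\in X(e_0;\mathbf B)$ with $|\Omega_h|=d$. If $\bar h^-$ is constant, then $\bar h$ has no vertical cuts: $\Sigma_{\bar h}=\emptyset$. -/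

import Mathlib

open MeasureTheory Set
open scoped ContDiff CompactlySupported

noncomputable section

namespace EpitaxialFilm

/-- The Euclidean plane; a point is `z = (x, y) = (z 0, z 1)`. -/
abbrev Plane : Type := EuclideanSpace ℝ (Fin 2)

/-- `2 × 2` real matrices. -/
abbrev Mat : Type := Matrix (Fin 2) (Fin 2) ℝ

/-- The vector `𝐞₁ = (1, 0)`. -/
def e₁ : Plane := EuclideanSpace.single 0 1

/-- The vector `𝐞₂ = (0, 1)`. -/
def e₂ : Plane := EuclideanSpace.single 1 1

/-! ### Profiles and their geometry -/

/-- The class `AP(0, ℓ)`: nonnegative, lower semicontinuous, `ℓ`-periodic profiles whose pointwise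
total variation over `(0, ℓ)` is finite. -/
structure AdmissibleProfile (ℓ : ℝ) (h : ℝ → ℝ) : Prop where
  nonneg : ∀ x, 0 ≤ h x
  lowerSemicontinuous : LowerSemicontinuous h
  periodic : Function.Periodic h ℓ
  boundedVariation : BoundedVariationOn h (Ioo 0 ℓ)

/-- `h⁻(x) = min {h(x+), h(x-)}`. -/
def lowerLim (h : ℝ → ℝ) (x : ℝ) : ℝ := min (Function.rightLim h x) (Function.leftLim h x)

/-- `h⁺(x) = max {h(x+), h(x-)}`. -/
def upperLim (h : ℝ → ℝ) (x : ℝ) : ℝ := max (Function.rightLim h x) (Function.leftLim h x)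

/-- The reference configuration `Ω_h` of the film (one period). -/
def film (ℓ : ℝ) (h : ℝ → ℝ) : Set Plane :=
  {z | z 0 ∈ Ico 0 ℓ ∧ 0 < z 1 ∧ z 1 < h (z 0)}

/-- The set `Ω_h^#`, the film repeated periodically. -/
def filmSharp (h : ℝ → ℝ) : Set Plane :=
  {z | 0 < z 1 ∧ z 1 < h (z 0)}

/-- The region lying strictly below the profile: `Ω_h^#`, the interface where `h > 0`, and the
half plane `y < 0`. It is open when `h` is lower semicontinuous. -/
def subgraph (h : ℝ → ℝ) : Set Plane := {z | z 1 < h (z 0)}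

/-- The (extended) graph `Γ_h`. -/
def graphSet (ℓ : ℝ) (h : ℝ → ℝ) : Set Plane :=
  {z | z 0 ∈ Ico 0 ℓ ∧ lowerLim h (z 0) ≤ z 1 ∧ z 1 ≤ upperLim h (z 0)}

/-- The set `Σ_h` of vertical cracks (vertical cuts). -/
def verticalCracks (ℓ : ℝ) (h : ℝ → ℝ) : Set Plane :=
  {z | z 0 ∈ Ico 0 ℓ ∧ h (z 0) < lowerLim h (z 0) ∧ h (z 0) ≤ z 1 ∧ z 1 ≤ lowerLim h (z 0)}

/-- The `ℓ`-periodic extension in the `x`-direction `H^#` of a field `H`, of which only the values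
on `0 ≤ x < ℓ` are used. -/
def periodicExt {α : Type*} (ℓ : ℝ) (H : Plane → α) (z : Plane) : α :=
  H (z - ((⌊z 0 / ℓ⌋ : ℝ) * ℓ) • e₁)

/-! ### Dislocation measures and their regularization -/

/-- A nonnegative radially symmetric `ϱ ∈ C_c^∞(B_1(0))` with unit integral. -/
structure Mollifier where
  toFun : Plane → ℝ
  smooth : ContDiff ℝ ∞ toFun
  tsupport_subset : tsupport toFun ⊆ Metric.ball 0 1
  nonneg : ∀ z, 0 ≤ toFun z
  radial : ∀ z w, ‖z‖ = ‖w‖ → toFun z = toFun w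
  integral_eq_one : ∫ z, toFun z = 1

/-- `ϱ_{r₀}(z) = ϱ(z / r₀) / r₀²`. -/
def Mollifier.scaled (ϱ : Mollifier) (r₀ : ℝ) (z : Plane) : ℝ :=
  1 / r₀ ^ 2 * ϱ.toFun (r₀⁻¹ • z)

theorem Mollifier.continuous_kernel (ϱ : Mollifier) (r₀ : ℝ) (w : Plane) :
    Continuous fun z => ϱ.scaled r₀ (w - z) := by
  have := ϱ.smooth.continuous
  unfold Mollifier.scaled
  fun_prop

theorem Mollifier.hasCompactSupport_kernel (ϱ : Mollifier) (r₀ : ℝ) (w : Plane) :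
    HasCompactSupport fun z => ϱ.scaled r₀ (w - z) := by
  rcases eq_or_ne r₀ 0 with rfl | hr
  · have : (fun z => ϱ.scaled 0 (w - z)) = 0 := by
      funext z
      simp [Mollifier.scaled]
    rw [this]
    exact HasCompactSupport.zero
  · refine HasCompactSupport.intro (isCompact_closedBall w |r₀|) fun z hz => ?_
    have h1 : r₀⁻¹ • (w - z) ∉ tsupport ϱ.toFun := by
      intro hmem
      apply hz
      have h2 := ϱ.tsupport_subset hmem
      rw [mem_ball_zero_iff, norm_smul, norm_inv, Real.norm_eq_abs,
        inv_mul_lt_iff₀ (abs_pos.mpr hr), mul_one] at h2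
      rw [Metric.mem_closedBall, dist_comm, dist_eq_norm]
      exact h2.le
    simp [Mollifier.scaled, image_eq_zero_of_notMem_tsupport h1]

/-- The test function `z ↦ ϱ_{r₀}(w - z)`. -/
def Mollifier.kernel (ϱ : Mollifier) (r₀ : ℝ) (w : Plane) : C_c(Plane, ℝ) where
  toFun z := ϱ.scaled r₀ (w - z)
  continuous_toFun := ϱ.continuous_kernel r₀ w
  hasCompactSupport' := ϱ.hasCompactSupport_kernel r₀ w

/-- `ℝ²`-valued Radon measures, given through their action `φ ↦ ∫ φ dσ` on `C_c`.
The only elements that are used are the dislocation measures below. -/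
abbrev RadonVec : Type := C_c(Plane, ℝ) → Plane

/-- `δ_z^# = ∑_{m ∈ ℤ} δ_{z + m ℓ 𝐞₁}`. -/
def periodicDirac (ℓ : ℝ) (z : Plane) : Measure Plane :=
  Measure.sum fun m : ℤ => Measure.dirac (z + ((m : ℝ) * ℓ) • e₁)

/-- The dislocation measure `∑ᵢ 𝐛ᵢ δ_{zᵢ}^#`. -/
def dislocationMeasure {k : ℕ} (ℓ : ℝ) (b z : Fin k → Plane) : RadonVec :=
  fun φ => ∑ i, (∫ w, φ w ∂(periodicDirac ℓ (z i))) • b i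

/-- The set `M_dis(Ω_h; 𝐁)`; the centers need not be distinct. -/
def dislocationMeasures {k : ℕ} (ℓ r₀ : ℝ) (b : Fin k → Plane) (h : ℝ → ℝ) : Set RadonVec :=
  {σ | ∃ z : Fin k → Plane, (∀ i, z i ∈ film ℓ h ∧ Metric.ball (z i) r₀ ⊆ filmSharp h) ∧
    σ = dislocationMeasure ℓ b z}

/-- The function `σ * ϱ_{r₀}`. -/
def regularized (ϱ : Mollifier) (r₀ : ℝ) (σ : RadonVec) (w : Plane) : Plane :=
  σ (ϱ.kernel r₀ w)

/-! ### Strain fields -/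

/-- `φ ∈ C_c^∞(U)`. -/
structure IsTest (U : Set Plane) (φ : Plane → ℝ) : Prop where
  smooth : ContDiff ℝ ∞ φ
  hasCompactSupport : HasCompactSupport φ
  tsupport_subset : tsupport φ ⊆ U

/-- `curl H = g` in the sense of distributions in the open set `U`, where
`(curl H)ᵢ = ∂ₓ Hᵢ₂ - ∂ᵧ Hᵢ₁` for the two rows of `H`. -/
def IsWeakCurl (U : Set Plane) (H : Plane → Mat) (g : Plane → Plane) : Prop :=
  ∀ φ : Plane → ℝ, IsTest U φ → ∀ i : Fin 2,
    ∫ z in U, g z i * φ z =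
      ∫ z in U, (H z i 0 * fderiv ℝ φ z e₂ - H z i 1 * fderiv ℝ φ z e₁)

/-- For a field `H` on `Ω_h^#` with `curl H = g`, the tangential trace `H[𝐞₁]` on the interface
`{y = 0}` equals the constant vector `t`. As usual the trace is defined by Green's formula, here
against test functions that need not vanish on the part of `{y = 0}` where `h > 0`. -/
def HasTangentialTrace (h : ℝ → ℝ) (H : Plane → Mat) (g : Plane → Plane) (t : Plane) : Prop :=
  ∀ φ : Plane → ℝ, IsTest (subgraph h) φ → ∀ i : Fin 2,
    ∫ z in filmSharp h, g z i * φ z =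
      (∫ z in filmSharp h, (H z i 0 * fderiv ℝ φ z e₂ - H z i 1 * fderiv ℝ φ z e₁))
        + ∫ x : ℝ, t i * φ !₂[x, 0]

/-- The space `𝐇_#(curl; Ω_h; 𝕄^{2×2})`. Local square integrability is understood in the periodic
film up to the interface `{y = 0}` (but away from the profile), so that a tangential trace
on the interface makes sense. -/
structure MemHcurl (ℓ : ℝ) (h : ℝ → ℝ) (H : Plane → Mat) : Prop where
  memLp_loc : ∀ K : Set Plane, IsCompact K → K ⊆ subgraph h → ∀ i j,
    MemLp (fun z => periodicExt ℓ H z i j) 2 (volume.restrict (K ∩ filmSharp h))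
  exists_curl : ∃ g : Plane → Plane, IsWeakCurl (filmSharp h) (periodicExt ℓ H) g ∧
    MemLp g 2 (volume.restrict (film ℓ h)) ∧
    ∀ K : Set Plane, IsCompact K → K ⊆ filmSharp h → MemLp g 2 (volume.restrict K)

/-- Membership `(h, σ, H) ∈ X(e₀; 𝐁)`. -/
structure Admissible {k : ℕ} (ℓ r₀ e₀ : ℝ) (ϱ : Mollifier) (b : Fin k → Plane)
    (h : ℝ → ℝ) (σ : RadonVec) (H : Plane → Mat) : Prop where
  profile : AdmissibleProfile ℓ h
  dislocation : σ ∈ dislocationMeasures ℓ r₀ b h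
  memHcurl : MemHcurl ℓ h H
  curl_eq : IsWeakCurl (filmSharp h) (periodicExt ℓ H) (regularized ϱ r₀ σ)
  trace_eq : HasTangentialTrace h (periodicExt ℓ H) (regularized ϱ r₀ σ) (e₀ • e₁)

/-! ### Energy and minimizers -/

/-- The symmetric part `(H + Hᵀ) / 2`. -/
def symPart (H : Mat) : Mat := (1 / 2 : ℝ) • (H + H.transpose)

/-- The elastic energy density `W(E) = μ |E|² + (λ / 2) (tr E)²`. -/
def elasticDensity (lam mu : ℝ) (E : Mat) : ℝ :=
  mu * (∑ i, ∑ j, E i j ^ 2) + lam / 2 * E.trace ^ 2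

open scoped MeasureTheory in
/-- The total energy `F(h, σ, H) ∈ [0, ∞]` (it depends on `σ` only through `H`). -/
def totalEnergy (ℓ lam mu γ : ℝ) (h : ℝ → ℝ) (H : Plane → Mat) : ENNReal :=
  (∫⁻ z in film ℓ h, ENNReal.ofReal (elasticDensity lam mu (symPart (H z))))
    + ENNReal.ofReal γ * μH[1] (graphSet ℓ h)
    + 2 * ENNReal.ofReal γ * μH[1] (verticalCracks ℓ h)

/-- `(h, σ, H)` minimizes `F` among all `(g, τ, K) ∈ X(e₀; 𝐁)` with `|Ω_g| = d`. -/
structure IsVolumeConstrainedMinimizer {k : ℕ} (ℓ r₀ e₀ lam mu γ d : ℝ) (ϱ : Mollifier)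
    (b : Fin k → Plane) (h : ℝ → ℝ) (σ : RadonVec) (H : Plane → Mat) : Prop where
  admissible : Admissible ℓ r₀ e₀ ϱ b h σ H
  volume_eq : volume (film ℓ h) = ENNReal.ofReal d
  le_energy : ∀ (g : ℝ → ℝ) (τ : RadonVec) (K : Plane → Mat),
    Admissible ℓ r₀ e₀ ϱ b g τ K → volume (film ℓ g) = ENNReal.ofReal d →
    totalEnergy ℓ lam mu γ h H ≤ totalEnergy ℓ lam mu γ g K

end EpitaxialFilm

end

open EpitaxialFilm

/-!
A cut counts twice in the energy, whereas a V-shaped notch of depth and half-width `δ` lengthens the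
graph of the profile by only `2 (√2 - 1) δ ≤ δ`. Opening such a notch at the mouth of a cut shortens
the cut by `δ` and therefore lowers the surface energy by at least `γ δ`. The area lost is of order
`δ²`, and it is restored by lifting the film onto a flat layer of the same area. This layer carries
the constant field prescribed by the tangential trace, so its elastic energy is of order `δ²` too,
and for small `δ` the total energy decreases.

The total energy of the minimizer is finite, because the flat film of the same area and with the
same dislocations carries a continuous field. The dislocation cores stay inside the notched film: a
disc of radius `r₀` lying below the profile misses the lower tip of the cut, and so stays away from
a small neighbourhood of its mouth.
-/

noncomputable section

namespace EpitaxialFilm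

open Filter Topology
open scoped MeasureTheory NNReal

/-! ### Profiles -/

theorem boundedVariationOn_of_edist_le {α E F G : Type*} [LinearOrder α] [PseudoEMetricSpace E]
    [PseudoEMetricSpace F] [PseudoEMetricSpace G] {f : α → E} {g : α → F} {u : α → G} {s : Set α}
    (hf : BoundedVariationOn f s) (hg : BoundedVariationOn g s)
    (hu : ∀ x ∈ s, ∀ y ∈ s, edist (u x) (u y) ≤ edist (f x) (f y) + edist (g x) (g y)) :
    BoundedVariationOn u s := by
  refine ne_top_of_le_ne_top (ENNReal.add_ne_top.2 ⟨hf, hg⟩) (iSup_le ?_)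
  rintro ⟨n, p, hp, hps⟩
  calc ∑ i ∈ Finset.range n, edist (u (p (i + 1))) (u (p i))
      ≤ ∑ i ∈ Finset.range n,
          (edist (f (p (i + 1))) (f (p i)) + edist (g (p (i + 1))) (g (p i))) :=
        Finset.sum_le_sum fun i _ => hu _ (hps _) _ (hps _)
    _ ≤ eVariationOn f s + eVariationOn g s := by
        rw [Finset.sum_add_distrib]
        exact add_le_add (eVariationOn.sum_le hp hps) (eVariationOn.sum_le hp hps)

theorem boundedVariationOn_min {α : Type*} [LinearOrder α] {f g : α → ℝ} {s : Set α}
    (hf : BoundedVariationOn f s) (hg : BoundedVariationOn g s) :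
    BoundedVariationOn (fun x => min (f x) (g x)) s := by
  refine boundedVariationOn_of_edist_le hf hg fun x _ y _ => ?_
  simp only [edist_dist, Real.dist_eq]
  rw [← ENNReal.ofReal_add (abs_nonneg _) (abs_nonneg _)]
  refine ENNReal.ofReal_le_ofReal ((abs_min_sub_min_le_max _ _ _ _).trans ?_)
  exact max_le (le_add_of_nonneg_right (abs_nonneg _)) (le_add_of_nonneg_left (abs_nonneg _))

theorem tendsto_sub_const_nhdsGT (x a : ℝ) : Tendsto (· - a) (𝓝[>] x) (𝓝[>] (x - a)) :=
  ((continuous_sub_right a).tendsto x).inf (tendsto_principal_principal.2 fun _ hy =>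
    sub_lt_sub_right hy a)

theorem tendsto_sub_const_nhdsLT (x a : ℝ) : Tendsto (· - a) (𝓝[<] x) (𝓝[<] (x - a)) :=
  ((continuous_sub_right a).tendsto x).inf (tendsto_principal_principal.2 fun _ hy =>
    sub_lt_sub_right hy a)

theorem le_lowerLim {h : ℝ → ℝ} {x m L R : ℝ} (hL : Tendsto h (𝓝[<] x) (𝓝 L))
    (hR : Tendsto h (𝓝[>] x) (𝓝 R)) (hm : ∀ᶠ y in 𝓝 x, m ≤ h y) : m ≤ lowerLim h x := by
  rw [lowerLim, rightLim_eq_of_tendsto hR, leftLim_eq_of_tendsto hL]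
  exact le_min (ge_of_tendsto hR (hm.filter_mono nhdsWithin_le_nhds))
    (ge_of_tendsto hL (hm.filter_mono nhdsWithin_le_nhds))

theorem lowerLim_eq_of_tendsto {h : ℝ → ℝ} {c x : ℝ} (hc : Tendsto h (𝓝[≠] x) (𝓝 c)) :
    lowerLim h x = c := by
  rw [lowerLim, rightLim_eq_of_tendsto (hc.mono_left (nhdsGT_le_nhdsNE x)),
    leftLim_eq_of_tendsto (hc.mono_left (nhdsLT_le_nhdsNE x)), min_self]

theorem upperLim_eq_of_tendsto {h : ℝ → ℝ} {c x : ℝ} (hc : Tendsto h (𝓝[≠] x) (𝓝 c)) :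
    upperLim h x = c := by
  rw [upperLim, rightLim_eq_of_tendsto (hc.mono_left (nhdsGT_le_nhdsNE x)),
    leftLim_eq_of_tendsto (hc.mono_left (nhdsLT_le_nhdsNE x)), max_self]

theorem le_of_lowerSemicontinuousAt_of_tendsto {h : ℝ → ℝ} {c x : ℝ}
    (hh : LowerSemicontinuousAt h x) (hc : Tendsto h (𝓝[≠] x) (𝓝 c)) : h x ≤ c := by
  refine le_of_forall_lt fun m hm => ?_
  obtain ⟨m', hmm', hm'⟩ := exists_between hm
  have hev : ∀ᶠ y in 𝓝[≠] x, m' < h y := (hh m' hm').filter_mono nhdsWithin_le_nhds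
  exact hmm'.trans_le (ge_of_tendsto hc (hev.mono fun _ => le_of_lt))

namespace AdmissibleProfile

variable {ℓ : ℝ} {g h : ℝ → ℝ}

theorem of_lipschitzWith {K : ℝ≥0} (hg : LipschitzWith K g) (hg₀ : ∀ x, 0 ≤ g x)
    (hper : Function.Periodic g ℓ) : AdmissibleProfile ℓ g where
  nonneg := hg₀
  lowerSemicontinuous := hg.continuous.lowerSemicontinuous
  periodic := hper
  boundedVariation := by
    have hBV := hg.locallyBoundedVariationOn univ 0 ℓ (mem_univ _) (mem_univ _)
    exact hBV.mono (Ioo_subset_Icc_self.trans (univ_inter _).ge)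

theorem inf (hh : AdmissibleProfile ℓ h) (hg : AdmissibleProfile ℓ g) :
    AdmissibleProfile ℓ fun x => min (h x) (g x) where
  nonneg x := le_min (hh.nonneg x) (hg.nonneg x)
  lowerSemicontinuous := hh.lowerSemicontinuous.inf hg.lowerSemicontinuous
  periodic x := by simp only [hh.periodic x, hg.periodic x]
  boundedVariation := boundedVariationOn_min hh.boundedVariation hg.boundedVariation

theorem const_add (hh : AdmissibleProfile ℓ h) {t : ℝ} (ht : 0 ≤ t) :
    AdmissibleProfile ℓ fun x => t + h x where
  nonneg x := add_nonneg ht (hh.nonneg x)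
  lowerSemicontinuous := continuous_const.lowerSemicontinuous.add hh.lowerSemicontinuous
  periodic x := by simp only [hh.periodic x]
  boundedVariation := boundedVariationOn_of_edist_le hh.boundedVariation hh.boundedVariation
    fun x _ y _ => by rw [edist_add_left]; exact le_self_add

theorem measurable (hh : AdmissibleProfile ℓ h) : Measurable h :=
  hh.lowerSemicontinuous.measurable

theorem exists_tendsto_right (hℓ : 0 < ℓ) (hh : AdmissibleProfile ℓ h) (x : ℝ) :
    ∃ R, Tendsto h (𝓝[>] x) (𝓝 R) := by
  have hx := toIcoMod_mem_Ico hℓ 0 x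
  obtain ⟨R, hR⟩ := hh.boundedVariation.exists_tendsto_right (toIcoMod hℓ 0 x)
  have hset : Ioo 0 ℓ ∩ Ioi (toIcoMod hℓ 0 x) = Ioo (toIcoMod hℓ 0 x) ℓ := by
    rw [inter_comm, Ioi_inter_Ioo, sup_eq_left.2 hx.1]
  rw [hset, nhdsWithin_Ioo_eq_nhdsGT (by simpa using hx.2)] at hR
  exact ⟨R, (hR.comp (tendsto_sub_const_nhdsGT x _)).congr fun _ => hh.periodic.sub_zsmul_eq _⟩

theorem exists_tendsto_left (hℓ : 0 < ℓ) (hh : AdmissibleProfile ℓ h) (x : ℝ) :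
    ∃ L, Tendsto h (𝓝[<] x) (𝓝 L) := by
  have hx := toIocMod_mem_Ioc hℓ 0 x
  obtain ⟨L, hL⟩ := hh.boundedVariation.exists_tendsto_left (toIocMod hℓ 0 x)
  have hset : Ioo 0 ℓ ∩ Iio (toIocMod hℓ 0 x) = Ioo 0 (toIocMod hℓ 0 x) := by
    rw [Ioo_inter_Iio, min_eq_right (by simpa using hx.2)]
  rw [hset, nhdsWithin_Ioo_eq_nhdsLT (by simpa using hx.1)] at hL
  exact ⟨L, (hL.comp (tendsto_sub_const_nhdsLT x _)).congr fun _ => hh.periodic.sub_zsmul_eq _⟩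

theorem le_of_tendsto_nhdsWithin (hℓ : 0 < ℓ) (hh : AdmissibleProfile ℓ h) {c x L : ℝ}
    {s : Set ℝ} (hs : IsOpen s) [(𝓝[s] x).NeBot] (hc : ∀ y, lowerLim h y ≤ c)
    (hL : Tendsto h (𝓝[s] x) (𝓝 L)) : L ≤ c := by
  refine le_of_forall_lt fun m hm => ?_
  obtain ⟨m', hmm', hm'⟩ := exists_between hm
  have hev : ∀ᶠ y in 𝓝[s] x, ∀ᶠ z in 𝓝 y, m' < h z := by
    filter_upwards [eventually_eventually_nhdsWithin.2 (hL.eventually (lt_mem_nhds hm')),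
      self_mem_nhdsWithin] with y hy hys
    rwa [hs.nhdsWithin_eq hys] at hy
  obtain ⟨y, hy⟩ := hev.exists
  obtain ⟨R, hR⟩ := hh.exists_tendsto_right hℓ y
  obtain ⟨L, hL⟩ := hh.exists_tendsto_left hℓ y
  exact hmm'.trans_le ((le_lowerLim hL hR (hy.mono fun _ => le_of_lt)).trans (hc y))

theorem tendsto_of_lowerLim_eq (hℓ : 0 < ℓ) (hh : AdmissibleProfile ℓ h) {c : ℝ}
    (hc : ∀ x, lowerLim h x = c) (x : ℝ) : Tendsto h (𝓝[≠] x) (𝓝 c) := by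
  obtain ⟨R, hR⟩ := hh.exists_tendsto_right hℓ x
  obtain ⟨L, hL⟩ := hh.exists_tendsto_left hℓ x
  have hmin : min R L = c := by
    rw [← hc x, lowerLim, rightLim_eq_of_tendsto hR, leftLim_eq_of_tendsto hL]
  have hR_eq : R = c := le_antisymm
    (hh.le_of_tendsto_nhdsWithin hℓ isOpen_Ioi (fun y => (hc y).le) hR) (hmin ▸ min_le_left _ _)
  have hL_eq : L = c := le_antisymm
    (hh.le_of_tendsto_nhdsWithin hℓ isOpen_Iio (fun y => (hc y).le) hL) (hmin ▸ min_le_right _ _)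
  rw [← Iio_union_Ioi, nhdsWithin_union, tendsto_sup]
  exact ⟨hL_eq ▸ hL, hR_eq ▸ hR⟩

theorem ae_eq_of_tendsto (hh : AdmissibleProfile ℓ h) {c : ℝ}
    (hc : ∀ x, Tendsto h (𝓝[≠] x) (𝓝 c)) : ∀ᵐ x, x ∈ Ico 0 ℓ → h x = c := by
  have h_ne : ∀ᵐ x : ℝ, x ≠ 0 := compl_mem_ae_iff.2 (measure_singleton 0)
  filter_upwards [hh.boundedVariation.locallyBoundedVariationOn.ae_differentiableWithinAt_of_mem,
    h_ne] with x hx hx_ne hmem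
  have hmem' : x ∈ Ioo 0 ℓ := ⟨hmem.1.lt_of_ne' hx_ne, hmem.2⟩
  have hcont : ContinuousAt h x :=
    (hx hmem').continuousWithinAt.continuousAt (isOpen_Ioo.mem_nhds hmem')
  exact tendsto_nhds_unique (hcont.tendsto.mono_left nhdsWithin_le_nhds) (hc x)

theorem exists_le (hℓ : 0 < ℓ) (hh : AdmissibleProfile ℓ h) : ∃ M, ∀ x, h x ≤ M := by
  set M := h (ℓ / 2) + (eVariationOn h (Ioo 0 ℓ)).toReal
  have hM_Ioo : ∀ x ∈ Ioo 0 ℓ, h x ≤ M := fun x hx => by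
    linarith [hh.boundedVariation.sub_le hx (y := ℓ / 2) ⟨by linarith, by linarith⟩]
  refine ⟨max M (h 0), fun x => ?_⟩
  have hx := toIcoMod_mem_Ico hℓ 0 x
  rw [zero_add] at hx
  rw [← hh.periodic.sub_zsmul_eq (toIcoDiv hℓ 0 x)]
  change h (toIcoMod hℓ 0 x) ≤ _
  rcases hx.1.eq_or_lt with h_eq | h_lt
  · exact h_eq ▸ le_max_right _ _
  · exact (hM_Ioo _ ⟨h_lt, hx.2⟩).trans (le_max_left _ _)

end AdmissibleProfile

/-! ### Coordinates, areas and lengths -/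

/-- The identification `z ↦ (z 0, z 1)` of the plane with `ℝ × ℝ`, which carries the Euclidean
volume to the product measure and so gives access to Fubini's theorem. -/
def planeEquiv : Plane ≃ᵐ ℝ × ℝ :=
  (MeasurableEquiv.toLp 2 (Fin 2 → ℝ)).symm.trans MeasurableEquiv.finTwoArrow

theorem planeEquiv_apply (z : Plane) : planeEquiv z = (z 0, z 1) := rfl

theorem measurePreserving_planeEquiv : MeasurePreserving planeEquiv volume volume :=
  (EuclideanSpace.volume_preserving_symm_measurableEquiv_toLp (Fin 2)).trans
    (volume_preserving_finTwoArrow ℝ)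

theorem eta_plane (z : Plane) : !₂[z 0, z 1] = z := by
  ext i; fin_cases i <;> rfl

@[simp] theorem add_smul_e₁_zero (z : Plane) (t : ℝ) : (z + t • e₁) 0 = z 0 + t := by simp [e₁]

@[simp] theorem add_smul_e₁_one (z : Plane) (t : ℝ) : (z + t • e₁) 1 = z 1 := by simp [e₁]

@[simp] theorem sub_smul_e₁_one (z : Plane) (t : ℝ) : (z - t • e₁) 1 = z 1 := by simp [e₁]

@[simp] theorem add_smul_e₂_zero (z : Plane) (t : ℝ) : (z + t • e₂) 0 = z 0 := by simp [e₂]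

@[simp] theorem add_smul_e₂_one (z : Plane) (t : ℝ) : (z + t • e₂) 1 = z 1 + t := by simp [e₂]

@[simp] theorem sub_smul_e₂_zero (z : Plane) (t : ℝ) : (z - t • e₂) 0 = z 0 := by simp [e₂]

@[simp] theorem sub_smul_e₂_one (z : Plane) (t : ℝ) : (z - t • e₂) 1 = z 1 - t := by simp [e₂]

theorem film_eq_preimage (ℓ : ℝ) (h : ℝ → ℝ) :
    film ℓ h = planeEquiv ⁻¹' regionBetween (fun _ => 0) h (Ico 0 ℓ) := rfl

theorem measurableSet_film (ℓ : ℝ) {h : ℝ → ℝ} (hh : Measurable h) :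
    MeasurableSet (film ℓ h) :=
  planeEquiv.measurable (measurableSet_regionBetween measurable_const hh measurableSet_Ico)

theorem volume_film (ℓ : ℝ) {h : ℝ → ℝ} (hh : Measurable h) :
    volume (film ℓ h) = ∫⁻ x in Ico 0 ℓ, ENNReal.ofReal (h x) := by
  rw [film_eq_preimage, measurePreserving_planeEquiv.measure_preimage_equiv,
    Measure.volume_eq_prod,
    volume_regionBetween_eq_lintegral' measurable_const hh measurableSet_Ico]
  simp only [Pi.sub_apply, sub_zero]

theorem volume_film_congr (ℓ : ℝ) {g h : ℝ → ℝ} (hg : Measurable g) (hh : Measurable h)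
    (hgh : ∀ᵐ x, x ∈ Ico 0 ℓ → g x = h x) : volume (film ℓ g) = volume (film ℓ h) := by
  rw [volume_film ℓ hg, volume_film ℓ hh]
  refine setLIntegral_congr_fun_ae measurableSet_Ico ?_
  filter_upwards [hgh] with x hx hmem
  rw [hx hmem]

theorem volume_film_const_add {ℓ t : ℝ} {g : ℝ → ℝ} (hg : Measurable g) (hg₀ : ∀ x, 0 ≤ g x)
    (ht : 0 ≤ t) : volume (film ℓ fun x => t + g x) =
      ENNReal.ofReal t * ENNReal.ofReal ℓ + volume (film ℓ g) := by
  rw [volume_film ℓ (hg.const_add t), volume_film ℓ hg]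
  simp only [ENNReal.ofReal_add ht (hg₀ _)]
  rw [lintegral_add_left measurable_const, setLIntegral_const, Real.volume_Ico, sub_zero]

theorem film_mono (ℓ : ℝ) {g h : ℝ → ℝ} (hgh : ∀ x, g x ≤ h x) : film ℓ g ⊆ film ℓ h :=
  fun _ hz => ⟨hz.1, hz.2.1, hz.2.2.trans_le (hgh _)⟩

theorem film_subset_image_Icc {ℓ M : ℝ} {h : ℝ → ℝ} (hM : ∀ x, h x ≤ M) :
    film ℓ h ⊆ (EuclideanSpace.equiv (Fin 2) ℝ).symm '' Icc ![0, 0] ![ℓ, M] := fun z hz => by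
  refine ⟨z, ?_, rfl⟩
  simp only [mem_Icc, Pi.le_def, Fin.forall_fin_two, Matrix.cons_val_zero, Matrix.cons_val_one]
  exact ⟨⟨hz.1.1, hz.2.1.le⟩, hz.1.2.le, hz.2.2.le.trans (hM _)⟩

theorem exists_isCompact_film_subset {ℓ M : ℝ} {h : ℝ → ℝ} (hM : ∀ x, h x ≤ M) :
    ∃ K, IsCompact K ∧ film ℓ h ⊆ K :=
  ⟨_, isCompact_Icc.image (EuclideanSpace.equiv (Fin 2) ℝ).symm.continuous,
    film_subset_image_Icc hM⟩

theorem filmSharp_mono {g h : ℝ → ℝ} (hgh : ∀ x, g x ≤ h x) : filmSharp g ⊆ filmSharp h :=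
  fun _ hz => ⟨hz.1, hz.2.trans_le (hgh _)⟩

theorem subgraph_mono {g h : ℝ → ℝ} (hgh : ∀ x, g x ≤ h x) : subgraph g ⊆ subgraph h :=
  fun _ hz => lt_of_lt_of_le hz (hgh _)

theorem isometry_horizontal (a : ℝ) : Isometry fun x : ℝ => (!₂[x, a] : Plane) :=
  Isometry.of_dist_eq fun x y => by
    simp [EuclideanSpace.dist_eq, Fin.sum_univ_two, Real.sqrt_sq_eq_abs, Real.dist_eq]

theorem isometry_vertical (a : ℝ) : Isometry fun y : ℝ => (!₂[a, y] : Plane) :=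
  Isometry.of_dist_eq fun x y => by
    simp [EuclideanSpace.dist_eq, Fin.sum_univ_two, Real.sqrt_sq_eq_abs, Real.dist_eq]

theorem lipschitzWith_graph {K : ℝ≥0} {f : ℝ → ℝ} (hf : LipschitzWith K f) :
    LipschitzWith (NNReal.sqrt (1 + K ^ 2)) fun x : ℝ => (!₂[x, f x] : Plane) :=
  LipschitzWith.of_dist_le_mul fun x y => by
    have h_dist := hf.dist_le_mul x y
    calc dist (!₂[x, f x] : Plane) !₂[y, f y] = √(dist x y ^ 2 + dist (f x) (f y) ^ 2) := by
          simp [EuclideanSpace.dist_eq, Fin.sum_univ_two]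
      _ ≤ √(dist x y ^ 2 + (K * dist x y) ^ 2) := by gcongr
      _ = √((1 + (K : ℝ) ^ 2) * dist x y ^ 2) := by ring_nf
      _ = NNReal.sqrt (1 + K ^ 2) * dist x y := by
          rw [Real.sqrt_mul (by positivity), Real.sqrt_sq dist_nonneg]
          simp

theorem hausdorffMeasure_graph_le {K : ℝ≥0} {f : ℝ → ℝ} (hf : LipschitzWith K f) (s : Set ℝ) :
    μH[1] ((fun x : ℝ => (!₂[x, f x] : Plane)) '' s) ≤ NNReal.sqrt (1 + K ^ 2) * volume s := by
  have h_image := (lipschitzWith_graph hf).hausdorffMeasure_image_le zero_le_one s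
  rwa [hausdorffMeasure_real, ENNReal.rpow_one] at h_image

theorem hausdorffMeasure_horizontal (a : ℝ) (s : Set ℝ) :
    μH[1] ((fun x : ℝ => (!₂[x, a] : Plane)) '' s) = volume s := by
  rw [(isometry_horizontal a).hausdorffMeasure_image (Or.inl zero_le_one), hausdorffMeasure_real]

theorem hausdorffMeasure_vertical (a : ℝ) (s : Set ℝ) :
    μH[1] ((fun y : ℝ => (!₂[a, y] : Plane)) '' s) = volume s := by
  rw [(isometry_vertical a).hausdorffMeasure_image (Or.inl zero_le_one), hausdorffMeasure_real]

theorem measurableSet_vertical (a : ℝ) {s : Set ℝ} (hs : MeasurableSet s) :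
    MeasurableSet ((fun y : ℝ => (!₂[a, y] : Plane)) '' s) :=
  (isometry_vertical a).isClosedEmbedding.measurableEmbedding.measurableSet_image.2 hs

theorem graphSet_eq_image_of_tendsto (ℓ : ℝ) {h f : ℝ → ℝ}
    (hf : ∀ x, Tendsto h (𝓝[≠] x) (𝓝 (f x))) :
    graphSet ℓ h = (fun x : ℝ => (!₂[x, f x] : Plane)) '' Ico 0 ℓ := by
  ext z
  simp only [graphSet, lowerLim_eq_of_tendsto (hf _), upperLim_eq_of_tendsto (hf _),
    mem_ofPred_eq, mem_image]
  constructor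
  · rintro ⟨hz₀, h_le, h_ge⟩
    exact ⟨z 0, hz₀, by rw [le_antisymm h_le h_ge, eta_plane]⟩
  · rintro ⟨x, hx, rfl⟩
    exact ⟨hx, le_rfl, le_rfl⟩

theorem hausdorffMeasure_graphSet_of_tendsto {ℓ c : ℝ} {h : ℝ → ℝ}
    (hc : ∀ x, Tendsto h (𝓝[≠] x) (𝓝 c)) : μH[1] (graphSet ℓ h) = ENNReal.ofReal ℓ := by
  rw [graphSet_eq_image_of_tendsto ℓ hc, hausdorffMeasure_horizontal, Real.volume_Ico, sub_zero]

/-! ### The notch -/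

/-- The depth at `x` of a V-shaped notch of slope one and of depth `δ`, centred at `x₀` and
repeated with period `ℓ`. The norm in `AddCircle ℓ` is the distance to the lattice `ℓ ℤ`. -/
def notchDepth (ℓ δ x₀ x : ℝ) : ℝ := max 0 (δ - ‖((x - x₀ : ℝ) : AddCircle ℓ)‖)

/-- The profile `h` cut off below the flat level `c` with a notch of depth `δ` at `x₀`. -/
def notchedProfile (ℓ δ x₀ c : ℝ) (h : ℝ → ℝ) (x : ℝ) : ℝ := min (h x) (c - notchDepth ℓ δ x₀ x)

section Notch

variable {ℓ δ x₀ c : ℝ} {h : ℝ → ℝ}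

theorem notchDepth_nonneg (x : ℝ) : 0 ≤ notchDepth ℓ δ x₀ x := le_max_left _ _

theorem notchDepth_le (hδ : 0 ≤ δ) (x : ℝ) : notchDepth ℓ δ x₀ x ≤ δ :=
  max_le hδ (sub_le_self _ (norm_nonneg _))

theorem notchDepth_self (hδ : 0 ≤ δ) : notchDepth ℓ δ x₀ x₀ = δ := by
  simp [notchDepth, hδ]

theorem periodic_notchDepth : Function.Periodic (notchDepth ℓ δ x₀) ℓ := fun x => by
  rw [notchDepth, notchDepth, add_sub_right_comm, AddCircle.coe_add_period]

theorem notchDepth_pos_iff {x : ℝ} :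
    0 < notchDepth ℓ δ x₀ x ↔ ‖((x - x₀ : ℝ) : AddCircle ℓ)‖ < δ := by
  simp [notchDepth]

theorem exists_int_notchDepth_eq (x : ℝ) :
    ∃ m : ℤ, notchDepth ℓ δ x₀ x = max 0 (δ - |x - (x₀ + m * ℓ)|) :=
  ⟨round (ℓ⁻¹ * (x - x₀)), by rw [notchDepth, AddCircle.norm_eq, sub_sub]⟩

theorem lipschitzWith_notchDepth : LipschitzWith 1 (notchDepth ℓ δ x₀) := by
  have h_mk : LipschitzWith 1 fun x : ℝ => ((x - x₀ : ℝ) : AddCircle ℓ) :=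
    LipschitzWith.mk_one fun x y => by
      rw [dist_eq_norm, ← AddCircle.coe_sub, sub_sub_sub_cancel_right, dist_eq_norm]
      exact QuotientAddGroup.norm_mk_le_norm
  have h_sub : LipschitzWith 1 fun x : ℝ => δ - ‖((x - x₀ : ℝ) : AddCircle ℓ)‖ := by
    simpa using (LipschitzWith.const δ).sub (lipschitzWith_one_norm.comp h_mk)
  exact h_sub.const_max 0

theorem lipschitzWith_const_sub_notchDepth :
    LipschitzWith 1 fun x => c - notchDepth ℓ δ x₀ x := by
  simpa using (LipschitzWith.const c).sub (lipschitzWith_notchDepth (ℓ := ℓ) (δ := δ) (x₀ := x₀))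

theorem measurableSet_notchDepth_pos : MeasurableSet {x | 0 < notchDepth ℓ δ x₀ x} :=
  (isOpen_lt continuous_const lipschitzWith_notchDepth.continuous).measurableSet

theorem volume_notchDepth_pos_le (hℓ : 0 < ℓ) :
    volume ({x | 0 < notchDepth ℓ δ x₀ x} ∩ Ico 0 ℓ) ≤ ENNReal.ofReal (2 * δ) := by
  have : Fact (0 < ℓ) := ⟨hℓ⟩
  have h_subset : {x | 0 < notchDepth ℓ δ x₀ x} ⊆
      (fun x : ℝ => (x : AddCircle ℓ)) ⁻¹' Metric.closedBall (x₀ : AddCircle ℓ) δ := fun x hx => by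
    rw [mem_preimage, Metric.mem_closedBall, dist_eq_norm, ← AddCircle.coe_sub]
    exact (notchDepth_pos_iff.1 hx).le
  rw [← Measure.restrict_apply measurableSet_notchDepth_pos,
    Measure.restrict_congr_set Ico_ae_eq_Ioc]
  refine (measure_mono h_subset).trans ?_
  have h_mp := AddCircle.measurePreserving_mk ℓ 0
  rw [zero_add] at h_mp
  rw [h_mp.measure_preimage measurableSet_closedBall.nullMeasurableSet,
    AddCircle.volume_closedBall]
  exact ENNReal.ofReal_le_ofReal (min_le_right _ _)

theorem notchedProfile_le (x : ℝ) : notchedProfile ℓ δ x₀ c h x ≤ h x := min_le_left _ _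

theorem admissibleProfile_notchedProfile (hh : AdmissibleProfile ℓ h) (hδ : 0 ≤ δ) (hδc : δ ≤ c) :
    AdmissibleProfile ℓ (notchedProfile ℓ δ x₀ c h) :=
  hh.inf <| .of_lipschitzWith lipschitzWith_const_sub_notchDepth
    (fun x => sub_nonneg.2 ((notchDepth_le hδ x).trans hδc))
    fun x => by simp only [periodic_notchDepth x]

theorem tendsto_notchedProfile {x : ℝ} (hc : Tendsto h (𝓝[≠] x) (𝓝 c)) :
    Tendsto (notchedProfile ℓ δ x₀ c h) (𝓝[≠] x) (𝓝 (c - notchDepth ℓ δ x₀ x)) := by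
  have h_notch : Tendsto (fun y => c - notchDepth ℓ δ x₀ y) (𝓝[≠] x)
      (𝓝 (c - notchDepth ℓ δ x₀ x)) :=
    (lipschitzWith_const_sub_notchDepth.continuous.tendsto x).mono_left nhdsWithin_le_nhds
  have h_min := hc.min h_notch
  rwa [min_eq_right (sub_le_self c (notchDepth_nonneg x))] at h_min

theorem volume_film_diff_notchedProfile_le (hℓ : 0 < ℓ) (hδ : 0 ≤ δ) (hc : ∀ x, h x ≤ c) :
    volume (film ℓ h \ film ℓ (notchedProfile ℓ δ x₀ c h)) ≤ ENNReal.ofReal (2 * δ * δ) := by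
  have h_subset : film ℓ h \ film ℓ (notchedProfile ℓ δ x₀ c h) ⊆
      planeEquiv ⁻¹' (({x | 0 < notchDepth ℓ δ x₀ x} ∩ Ico 0 ℓ) ×ˢ Icc (c - δ) c) := by
    rintro z ⟨⟨hz₀, hz_pos, hz_lt⟩, hz⟩
    have h_cut : c - notchDepth ℓ δ x₀ (z 0) ≤ z 1 := by
      by_contra! h_lt
      exact hz ⟨hz₀, hz_pos, lt_min hz_lt h_lt⟩
    have hz_c := hz_lt.trans_le (hc _)
    refine ⟨⟨?_, hz₀⟩, ?_, hz_c.le⟩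
    · change 0 < notchDepth ℓ δ x₀ (z 0)
      linarith
    · change c - δ ≤ z 1
      linarith [notchDepth_le (ℓ := ℓ) (x₀ := x₀) hδ (z 0)]
  refine (measure_mono h_subset).trans ?_
  rw [measurePreserving_planeEquiv.measure_preimage_equiv, Measure.volume_eq_prod,
    Measure.prod_prod, Real.volume_Icc, sub_sub_cancel, ENNReal.ofReal_mul (by positivity)]
  gcongr
  exact volume_notchDepth_pos_le hℓ

theorem hausdorffMeasure_graphSet_notchedProfile_le (hℓ : 0 < ℓ)
    (hc : ∀ x, Tendsto h (𝓝[≠] x) (𝓝 c)) :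
    μH[1] (graphSet ℓ (notchedProfile ℓ δ x₀ c h)) ≤ ENNReal.ofReal ℓ + ENNReal.ofReal δ := by
  set N := {x | 0 < notchDepth ℓ δ x₀ x}
  have h_flat : (fun x : ℝ => (!₂[x, c - notchDepth ℓ δ x₀ x] : Plane)) '' (Ico 0 ℓ \ N) =
      (fun x : ℝ => (!₂[x, c] : Plane)) '' (Ico 0 ℓ \ N) := image_congr fun x hx => by
    rw [le_antisymm (not_lt.1 hx.2) (notchDepth_nonneg x), sub_zero]
  have h_sqrt : (NNReal.sqrt (1 + 1 ^ 2) : ENNReal) ≤ 1 + ENNReal.ofReal (1 / 2) := by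
    rw [← ENNReal.ofReal_one, ← ENNReal.ofReal_add zero_le_one (by norm_num),
      ← ENNReal.ofReal_coe_nnreal]
    refine ENNReal.ofReal_le_ofReal ?_
    rw [Real.coe_sqrt, Real.sqrt_le_iff]
    norm_num
  rw [graphSet_eq_image_of_tendsto ℓ fun x => tendsto_notchedProfile (hc x),
    ← inter_union_sdiff (Ico 0 ℓ) N, image_union, h_flat, inter_comm]
  calc _ ≤ (NNReal.sqrt (1 + 1 ^ 2) : ENNReal) * volume (N ∩ Ico 0 ℓ)
          + volume (Ico 0 ℓ \ N) :=
        (measure_union_le _ _).trans <| add_le_add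
          (hausdorffMeasure_graph_le lipschitzWith_const_sub_notchDepth _)
          (hausdorffMeasure_horizontal _ _).le
    _ ≤ (1 + ENNReal.ofReal (1 / 2)) * volume (N ∩ Ico 0 ℓ) + volume (Ico 0 ℓ \ N) := by gcongr
    _ = (volume (Ico 0 ℓ ∩ N) + volume (Ico 0 ℓ \ N))
          + ENNReal.ofReal (1 / 2) * volume (N ∩ Ico 0 ℓ) := by
        rw [inter_comm]; ring
    _ ≤ ENNReal.ofReal ℓ + ENNReal.ofReal (1 / 2) * ENNReal.ofReal (2 * δ) := by
        rw [measure_inter_add_sdiff _ measurableSet_notchDepth_pos, Real.volume_Ico, sub_zero]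
        gcongr
        exact volume_notchDepth_pos_le hℓ
    _ = ENNReal.ofReal ℓ + ENNReal.ofReal δ := by
        rw [← ENNReal.ofReal_mul (by norm_num)]
        ring_nf

theorem verticalCracks_notchedProfile_subset (hc : ∀ x, Tendsto h (𝓝[≠] x) (𝓝 c)) :
    verticalCracks ℓ (notchedProfile ℓ δ x₀ c h) ⊆
      {z ∈ verticalCracks ℓ h | z 1 ≤ c - notchDepth ℓ δ x₀ (z 0)} := by
  rintro z ⟨hz₀, h_cut, h_le, h_ge⟩
  rw [lowerLim_eq_of_tendsto (tendsto_notchedProfile (hc _))] at h_cut h_ge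
  have h_lt : h (z 0) < c - notchDepth ℓ δ x₀ (z 0) :=
    (min_lt_iff.1 h_cut).resolve_right (lt_irrefl _)
  rw [notchedProfile, min_eq_left h_lt.le] at h_le
  have h_depth := notchDepth_nonneg (ℓ := ℓ) (δ := δ) (x₀ := x₀) (z 0)
  refine ⟨⟨hz₀, ?_, h_le, ?_⟩, h_ge⟩ <;> rw [lowerLim_eq_of_tendsto (hc _)] <;> linarith

theorem hausdorffMeasure_verticalCracks_notchedProfile_add_le (hδ : 0 < δ) (hx₀ : x₀ ∈ Ico 0 ℓ)
    (hc : ∀ x, Tendsto h (𝓝[≠] x) (𝓝 c)) (h_cut : h x₀ ≤ c - δ) :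
    μH[1] (verticalCracks ℓ (notchedProfile ℓ δ x₀ c h)) + ENNReal.ofReal δ ≤
      μH[1] (verticalCracks ℓ h) := by
  set S : Set Plane := (fun y : ℝ => (!₂[x₀, y] : Plane)) '' Ioc (c - δ) c with hS
  have h_subset := verticalCracks_notchedProfile_subset (ℓ := ℓ) (δ := δ) (x₀ := x₀) hc
  have h_disjoint : Disjoint (verticalCracks ℓ (notchedProfile ℓ δ x₀ c h)) S := by
    refine disjoint_left.2 fun z hz hzS => ?_
    obtain ⟨y, hy, rfl⟩ := hzS
    have hy_le : y ≤ c - notchDepth ℓ δ x₀ x₀ := (h_subset hz).2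
    rw [notchDepth_self hδ.le] at hy_le
    exact hy_le.not_gt hy.1
  have hS_subset : S ⊆ verticalCracks ℓ h := by
    rintro _ ⟨y, hy, rfl⟩
    refine ⟨hx₀, ?_, h_cut.trans hy.1.le, ?_⟩ <;> rw [lowerLim_eq_of_tendsto (hc _)]
    · exact h_cut.trans_lt (sub_lt_self c hδ)
    · exact hy.2
  have hS_length : μH[1] S = ENNReal.ofReal δ := by
    rw [hS, hausdorffMeasure_vertical, Real.volume_Ioc, sub_sub_cancel]
  rw [← hS_length, ← measure_union h_disjoint (measurableSet_vertical x₀ measurableSet_Ioc)]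
  exact measure_mono (union_subset (fun z hz => (h_subset hz).1) hS_subset)

end Notch

/-! ### Regularized dislocation measures and their cores -/

theorem Mollifier.continuous_scaled (ϱ : Mollifier) (r₀ : ℝ) : Continuous (ϱ.scaled r₀) := by
  simpa [Function.comp_def] using (ϱ.continuous_kernel r₀ 0).comp continuous_neg

theorem Mollifier.hasCompactSupport_scaled (ϱ : Mollifier) (r₀ : ℝ) :
    HasCompactSupport (ϱ.scaled r₀) := by
  simpa [Function.comp_def] using
    (ϱ.hasCompactSupport_kernel r₀ 0).comp_homeomorph (Homeomorph.neg Plane)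

theorem Mollifier.scaled_eq_zero (ϱ : Mollifier) {r₀ : ℝ} (hr₀ : 0 < r₀) {z : Plane}
    (hz : r₀ ≤ ‖z‖) : ϱ.scaled r₀ z = 0 := by
  have h_notMem : r₀⁻¹ • z ∉ tsupport ϱ.toFun := fun hmem => by
    have h_norm := ϱ.tsupport_subset hmem
    rw [mem_ball_zero_iff, norm_smul, norm_inv, Real.norm_of_nonneg hr₀.le,
      inv_mul_lt_iff₀ hr₀, mul_one] at h_norm
    exact h_norm.not_ge hz
  rw [Mollifier.scaled, image_eq_zero_of_notMem_tsupport h_notMem, mul_zero]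

theorem periodicDirac_add (ℓ : ℝ) (z v : Plane) :
    periodicDirac ℓ (z + v) = (periodicDirac ℓ z).map (· + v) := by
  rw [periodicDirac, periodicDirac, Measure.map_sum (measurable_add_const v).aemeasurable]
  congr 1
  funext m
  rw [Measure.map_dirac' (measurable_add_const v), add_right_comm]

theorem periodicDirac_add_period (ℓ : ℝ) (z : Plane) :
    periodicDirac ℓ (z + ℓ • e₁) = periodicDirac ℓ z := by
  rw [periodicDirac, periodicDirac, ← Measure.sum_comp_equiv (Equiv.addRight (1 : ℤ))
    fun m : ℤ => Measure.dirac (z + ((m : ℝ) * ℓ) • e₁)]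
  congr 1
  funext m
  simp only [Function.comp_apply, Equiv.coe_addRight, Int.cast_add, Int.cast_one, add_mul, one_mul,
    add_smul, add_comm (((m : ℝ) * ℓ) • e₁), add_assoc]

theorem isLocallyFiniteMeasure_periodicDirac {ℓ : ℝ} (hℓ : 0 < ℓ) (z : Plane) :
    IsLocallyFiniteMeasure (periodicDirac ℓ z) := by
  refine ⟨fun w => ⟨Metric.ball w 1, Metric.ball_mem_nhds w one_pos, ?_⟩⟩
  have hfin : {m : ℤ | z + ((m : ℝ) * ℓ) • e₁ ∈ Metric.ball w 1}.Finite := by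
    refine (finite_Icc ⌊(w 0 - z 0 - 1) / ℓ⌋ ⌈(w 0 - z 0 + 1) / ℓ⌉).subset fun m hm => ?_
    have h_abs : ‖(z + ((m : ℝ) * ℓ) • e₁ - w) 0‖ < 1 :=
      (PiLp.norm_apply_le _ 0).trans_lt (by simpa [dist_eq_norm] using hm)
    rw [PiLp.sub_apply, add_smul_e₁_zero, Real.norm_eq_abs, abs_lt] at h_abs
    have h_lower : (w 0 - z 0 - 1) / ℓ ≤ m := by rw [div_le_iff₀ hℓ]; linarith
    have h_upper : (m : ℝ) ≤ (w 0 - z 0 + 1) / ℓ := by rw [le_div_iff₀ hℓ]; linarith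
    exact ⟨Int.cast_le.1 ((Int.floor_le _).trans h_lower),
      Int.cast_le.1 (h_upper.trans (Int.le_ceil _))⟩
  rw [periodicDirac, Measure.sum_apply _ measurableSet_ball,
    tsum_eq_sum (s := hfin.toFinset) fun m hm => ?_]
  · exact ENNReal.sum_lt_top.2 fun m _ => measure_lt_top _ _
  · rw [Measure.dirac_apply' _ measurableSet_ball, indicator_of_notMem]
    simpa using hm

section Regularized

variable {k : ℕ} {ℓ r₀ : ℝ} (ϱ : Mollifier) (b z : Fin k → Plane)

theorem regularized_dislocationMeasure (w : Plane) :
    regularized ϱ r₀ (dislocationMeasure ℓ b z) w =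
      ∑ i, (∫ u, ϱ.scaled r₀ (w - u) ∂(periodicDirac ℓ (z i))) • b i := rfl

theorem regularized_dislocationMeasure_add (v w : Plane) :
    regularized ϱ r₀ (dislocationMeasure ℓ b fun i => z i + v) w =
      regularized ϱ r₀ (dislocationMeasure ℓ b z) (w - v) := by
  simp only [regularized_dislocationMeasure]
  refine Finset.sum_congr rfl fun i _ => ?_
  rw [periodicDirac_add,
    (measurableEmbedding_addRight v).integral_map (fun u => ϱ.scaled r₀ (w - u))]
  simp only [sub_add_eq_sub_sub_swap]

theorem periodic_regularized_dislocationMeasure :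
    Function.Periodic (regularized ϱ r₀ (dislocationMeasure ℓ b z)) (ℓ • e₁) := fun w => by
  rw [← add_sub_cancel_right w (ℓ • e₁), ← regularized_dislocationMeasure_add, sub_add_cancel]
  simp only [regularized_dislocationMeasure, periodicDirac_add_period]

theorem continuous_regularized_dislocationMeasure (hℓ : 0 < ℓ) :
    Continuous (regularized ϱ r₀ (dislocationMeasure ℓ b z)) := by
  simp only [funext (regularized_dislocationMeasure ϱ b z)]
  refine continuous_finsetSum _ fun i _ => Continuous.fun_smul ?_ continuous_const
  have := isLocallyFiniteMeasure_periodicDirac hℓ (z i)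
  have h_conv := (ϱ.hasCompactSupport_scaled r₀).continuous_convolution_right
    (ContinuousLinearMap.mul ℝ ℝ) (locallyIntegrable_const (1 : ℝ) (μ := periodicDirac ℓ (z i)))
    (ϱ.continuous_scaled r₀)
  refine h_conv.congr fun w => ?_
  simp only [convolution_def, ContinuousLinearMap.mul_apply', one_mul]

theorem regularized_dislocationMeasure_eq_zero {h : ℝ → ℝ} (hr₀ : 0 < r₀)
    (hz : ∀ i, Metric.ball (z i) r₀ ⊆ filmSharp h) {w : Plane} (hw : w 1 ≤ 0) :
    regularized ϱ r₀ (dislocationMeasure ℓ b z) w = 0 := by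
  rw [regularized_dislocationMeasure]
  refine Finset.sum_eq_zero fun i _ => ?_
  rw [integral_eq_zero_of_ae, zero_smul]
  refine Measure.ae_sum_iff.2 fun m => ?_
  rw [ae_dirac_eq, eventually_pure]
  have h_notMem : w - ((m : ℝ) * ℓ) • e₁ ∉ Metric.ball (z i) r₀ := fun hmem => by
    have h_pos := (hz i hmem).1
    rw [sub_smul_e₁_one] at h_pos
    exact h_pos.not_ge hw
  rw [mem_ball_iff_norm, not_lt, sub_sub, add_comm] at h_notMem
  exact ϱ.scaled_eq_zero hr₀ h_notMem

end Regularized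

theorem dist_le_abs_add_abs (p q : Plane) : dist p q ≤ |p 0 - q 0| + |p 1 - q 1| := by
  rw [EuclideanSpace.dist_eq, Fin.sum_univ_two, Real.dist_eq, Real.dist_eq, Real.sqrt_le_iff]
  exact ⟨by positivity, by nlinarith [mul_nonneg (abs_nonneg (p 0 - q 0)) (abs_nonneg (p 1 - q 1))]⟩

theorem height_add_le_of_ball_subset {h : ℝ → ℝ} {c : ℝ} (hc : ∀ x, h x ≤ c) {q : Plane} {r : ℝ}
    (hqc : q 1 ≤ c) (hq : Metric.ball q r ⊆ filmSharp h) : q 1 + r ≤ c := by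
  by_contra! hlt
  have h_top : q + (c - q 1) • e₂ ∈ Metric.ball q r := by
    rw [mem_ball_iff_norm, add_sub_cancel_left, norm_smul, Real.norm_of_nonneg (by linarith)]
    simpa [e₂] using by linarith
  have h_below := (hq h_top).2
  rw [add_smul_e₂_one, add_smul_e₂_zero] at h_below
  linarith [hc (q 0)]

theorem add_div_three_le_dist_of_notMem_ball {q : Plane} {r c D X : ℝ} (hD : 0 ≤ D) (hDr : D ≤ r)
    (hqc : q 1 + r ≤ c) (h_notMem : !₂[X, c - D] ∉ Metric.ball q r) :
    r + D / 3 ≤ dist !₂[X, c] q := by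
  rw [Metric.mem_ball, not_lt] at h_notMem
  rw [EuclideanSpace.dist_eq, Fin.sum_univ_two, Real.dist_eq, Real.dist_eq, sq_abs, sq_abs] at *
  simp only [Matrix.cons_val_zero, Matrix.cons_val_one] at *
  rw [Real.le_sqrt (hD.trans hDr) (by positivity)] at h_notMem
  refine Real.le_sqrt_of_sq_le ?_
  nlinarith

theorem ball_subset_filmSharp_notchedProfile {ℓ c δ x₀ r D : ℝ} {h : ℝ → ℝ}
    (hper : Function.Periodic h ℓ) (hc : ∀ x, h x ≤ c) (hD : 0 ≤ D) (hDr : D ≤ r)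
    (h_cut : h x₀ ≤ c - D) (hδ : δ ≤ D / 3) {q : Plane} (hqc : q 1 ≤ c)
    (hq : Metric.ball q r ⊆ filmSharp h) :
    Metric.ball q r ⊆ filmSharp (notchedProfile ℓ δ x₀ c h) := by
  intro p hp
  obtain ⟨hp_pos, hp_lt⟩ := hq hp
  refine ⟨hp_pos, lt_min hp_lt ?_⟩
  by_contra! h_notch
  obtain ⟨m, hm⟩ := exists_int_notchDepth_eq (ℓ := ℓ) (δ := δ) (x₀ := x₀) (p 0)
  have h_tip : !₂[x₀ + m * ℓ, c - D] ∉ Metric.ball q r := fun hmem => by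
    have h_below : c - D < h (x₀ + m * ℓ) := (hq hmem).2
    rw [hper.int_mul m x₀] at h_below
    exact h_below.not_ge h_cut
  have h_far := add_div_three_le_dist_of_notMem_ball hD hDr
    (height_add_le_of_ball_subset hc hqc hq) h_tip
  have h_near : dist !₂[x₀ + m * ℓ, c] p ≤ δ := by
    refine (dist_le_abs_add_abs _ p).trans ?_
    have hpc : p 1 < c := hp_lt.trans_le (hc _)
    have h_depth : 0 < δ - |p 0 - (x₀ + m * ℓ)| := by
      by_contra! h_nonpos
      rw [hm, max_eq_left h_nonpos] at h_notch
      linarith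
    rw [hm, max_eq_right h_depth.le] at h_notch
    simp only [Matrix.cons_val_zero, Matrix.cons_val_one]
    rw [abs_sub_comm, abs_of_pos (sub_pos.2 hpc)]
    linarith
  linarith [dist_triangle !₂[x₀ + m * ℓ, c] p q, Metric.mem_ball.1 hp]

/-! ### Green's formula -/

/-- The open half plane `y > a`. -/
def halfPlane (a : ℝ) : Set Plane := {z | a < z 1}

/-- The integrand `Hᵢ₁ ∂ᵧφ - Hᵢ₂ ∂ₓφ` of Green's formula for the `i`-th row of `H`. -/
def curlPairing (H : Plane → Mat) (φ : Plane → ℝ) (i : Fin 2) (z : Plane) : ℝ :=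
  H z i 0 * fderiv ℝ φ z e₂ - H z i 1 * fderiv ℝ φ z e₁

/-- Square integrability of `H` on `Ω_h^#` up to the interface `{y = 0}`, locally away from the
profile. -/
def LocallySquareIntegrable (h : ℝ → ℝ) (H : Plane → Mat) : Prop :=
  ∀ K : Set Plane, IsCompact K → K ⊆ subgraph h → ∀ i j,
    MemLp (fun z => H z i j) 2 (volume.restrict (K ∩ filmSharp h))

theorem measurableSet_halfPlane (a : ℝ) : MeasurableSet (halfPlane a) :=
  measurableSet_lt measurable_const (by fun_prop)

theorem inter_filmSharp_eq_inter_halfPlane {h : ℝ → ℝ} {K : Set Plane} (hK : K ⊆ subgraph h) :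
    K ∩ filmSharp h = K ∩ halfPlane 0 := by
  ext z
  exact ⟨fun hz => ⟨hz.1, hz.2.1⟩, fun hz => ⟨hz.1, hz.2, hK hz.1⟩⟩

theorem setIntegral_filmSharp_eq {h : ℝ → ℝ} {F : Plane → ℝ} (hF : ∀ z ∉ subgraph h, F z = 0) :
    ∫ z in filmSharp h, F z = ∫ z in halfPlane 0, F z := by
  have h_subset : filmSharp h ⊆ halfPlane 0 := fun _ hz => hz.1
  refine (setIntegral_eq_of_subset_of_forall_sdiff_eq_zero (measurableSet_halfPlane 0) h_subset
    fun z hz => ?_).symm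
  exact hF z fun hz' => hz.2 ⟨hz.1, hz'⟩

theorem setIntegral_halfPlane_sub (t : ℝ) (F : Plane → ℝ) :
    ∫ z in halfPlane t, F (z - t • e₂) = ∫ z in halfPlane 0, F z := by
  have h_preimage : halfPlane t = (· - t • e₂) ⁻¹' halfPlane 0 := by
    ext z
    change t < z 1 ↔ 0 < (z - t • e₂) 1
    rw [sub_smul_e₂_one, sub_pos]
  rw [h_preimage]
  exact (measurePreserving_sub_right volume (t • e₂)).setIntegral_preimage_emb
    (measurableEmbedding_subRight _) F _

theorem setIntegral_halfPlane_eq_neg_integral {F F' : Plane → ℝ} (hF : HasCompactSupport F)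
    (hF' : Integrable F')
    (hderiv : ∀ x y, HasDerivAt (fun s : ℝ => F !₂[x, s]) (F' !₂[x, y]) y) (a : ℝ) :
    ∫ z in halfPlane a, F' z = -∫ x : ℝ, F !₂[x, a] := by
  have h_preimage : halfPlane a = planeEquiv ⁻¹' ((univ : Set ℝ) ×ˢ Ioi a) := by
    ext z
    simp [planeEquiv_apply, halfPlane]
  have h_prod : Integrable (fun p : ℝ × ℝ => F' !₂[p.1, p.2]) := by
    rw [← measurePreserving_planeEquiv.integrable_comp_emb planeEquiv.measurableEmbedding]
    simpa only [Function.comp_def, planeEquiv_apply, eta_plane] using hF'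
  calc
    ∫ z in halfPlane a, F' z = ∫ p in (univ : Set ℝ) ×ˢ Ioi a, F' !₂[p.1, p.2] := by
      rw [h_preimage, ← measurePreserving_planeEquiv.setIntegral_preimage_emb
        planeEquiv.measurableEmbedding]
      simp only [planeEquiv_apply, eta_plane]
    _ = ∫ x : ℝ, ∫ y in Ioi a, F' !₂[x, y] := by
      rw [Measure.volume_eq_prod, setIntegral_prod _ h_prod.integrableOn, setIntegral_univ]
    _ = ∫ x : ℝ, -F !₂[x, a] := by
      refine integral_congr_ae ?_
      filter_upwards [h_prod.prod_right_ae] with x hx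
      have h_section := hF.comp_isClosedEmbedding (isometry_vertical x).isClosedEmbedding
      have h_vanish : Tendsto (fun s : ℝ => F !₂[x, s]) atTop (𝓝 0) :=
        h_section.is_zero_at_infty.mono_left atTop_le_cocompact
      rw [integral_Ioi_of_hasDerivAt_of_tendsto' (fun y _ => hderiv x y) hx.integrableOn h_vanish,
        zero_sub]
    _ = -∫ x : ℝ, F !₂[x, a] := integral_neg _

namespace IsTest

variable {U V : Set Plane} {φ : Plane → ℝ}

theorem continuous_fderiv_apply (hφ : IsTest U φ) (v : Plane) :
    Continuous fun z => fderiv ℝ φ z v :=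
  (hφ.smooth.continuous_fderiv (by simp)).clm_apply continuous_const

theorem hasCompactSupport_fderiv_apply (hφ : IsTest U φ) (v : Plane) :
    HasCompactSupport fun z => fderiv ℝ φ z v :=
  hφ.hasCompactSupport.fderiv_apply (𝕜 := ℝ) v

theorem eq_zero (hφ : IsTest U φ) {z : Plane} (hz : z ∉ U) : φ z = 0 :=
  image_eq_zero_of_notMem_tsupport fun h => hz (hφ.tsupport_subset h)

theorem curlPairing_eq_zero {z : Plane} (hz : z ∉ tsupport φ) (H : Plane → Mat) (i : Fin 2) :
    curlPairing H φ i z = 0 := by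
  have h_fderiv : fderiv ℝ φ z = 0 := by
    by_contra hne
    exact hz (support_fderiv_subset ℝ hne)
  simp only [curlPairing, h_fderiv, zero_apply, mul_zero, sub_zero]

theorem mono (hφ : IsTest U φ) (hUV : U ⊆ V) : IsTest V φ :=
  ⟨hφ.smooth, hφ.hasCompactSupport, hφ.tsupport_subset.trans hUV⟩

theorem hasDerivAt_vertical (hφ : IsTest U φ) (x y : ℝ) :
    HasDerivAt (fun s : ℝ => φ !₂[x, s]) (fderiv ℝ φ !₂[x, y] e₂) y := by
  have h_line : HasDerivAt (fun s : ℝ => (!₂[x, s] : Plane)) e₂ y := by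
    have h_affine := ((hasDerivAt_id y).smul_const e₂).const_add (!₂[x, 0] : Plane)
    rw [one_smul] at h_affine
    convert! h_affine using 1
    funext s
    ext i
    fin_cases i <;> simp [e₂]
  exact (hφ.smooth.differentiable (by simp) _).hasFDerivAt.comp_hasDerivAt y h_line

theorem setIntegral_halfPlane_fderiv (hφ : IsTest U φ) (a : ℝ) :
    ∫ z in halfPlane a, fderiv ℝ φ z e₂ = -∫ x : ℝ, φ !₂[x, a] :=
  setIntegral_halfPlane_eq_neg_integral hφ.hasCompactSupport
    ((hφ.continuous_fderiv_apply e₂).integrable_of_hasCompactSupport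
      (hφ.hasCompactSupport_fderiv_apply e₂)) hφ.hasDerivAt_vertical a

theorem integrableOn_curlPairing {h : ℝ → ℝ} {H : Plane → Mat} (hφ : IsTest (subgraph h) φ)
    (hH : LocallySquareIntegrable h H) (i : Fin 2) :
    IntegrableOn (curlPairing H φ i) (halfPlane 0) := by
  have h_compact : IsCompact (tsupport φ) := hφ.hasCompactSupport
  have h_term (j : Fin 2) (v : Plane) :
      IntegrableOn (fun z => H z i j * fderiv ℝ φ z v) (tsupport φ ∩ halfPlane 0) := by
    have : IsFiniteMeasure (volume.restrict (tsupport φ ∩ halfPlane 0)) :=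
      ⟨by simpa using (measure_mono inter_subset_left).trans_lt h_compact.measure_lt_top⟩
    have h_memLp := hH _ h_compact hφ.tsupport_subset i j
    rw [inter_filmSharp_eq_inter_halfPlane hφ.tsupport_subset] at h_memLp
    obtain ⟨C, hC⟩ := (hφ.continuous_fderiv_apply v).bounded_above_of_compact_support
      (hφ.hasCompactSupport_fderiv_apply v)
    exact (h_memLp.integrable one_le_two).mul_bdd
      (hφ.continuous_fderiv_apply v).aestronglyMeasurable (Eventually.of_forall hC)
  exact ((h_term 0 e₂).sub (h_term 1 e₁)).of_forall_sdiff_eq_zero (measurableSet_halfPlane 0)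
    fun z hz => curlPairing_eq_zero (fun hz' => hz.2 ⟨hz', hz.1⟩) H i

theorem comp_add_smul_e₂ {h : ℝ → ℝ} {t : ℝ} (hφ : IsTest (subgraph fun x => t + h x) φ) :
    IsTest (subgraph h) fun z => φ (z + t • e₂) where
  smooth := hφ.smooth.comp (by fun_prop)
  hasCompactSupport := hφ.hasCompactSupport.comp_homeomorph (Homeomorph.addRight (t • e₂))
  tsupport_subset z hz := by
    have h_mem : z + t • e₂ ∈ tsupport φ :=
      (tsupport_comp_subset_preimage φ (f := fun z => z + t • e₂) (by fun_prop)) hz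
    have h_lt : (z + t • e₂) 1 < t + h ((z + t • e₂) 0) := hφ.tsupport_subset h_mem
    rw [add_smul_e₂_one, add_smul_e₂_zero, add_comm, add_lt_add_iff_left] at h_lt
    exact h_lt

end IsTest

section Trace

variable {g h : ℝ → ℝ} {H : Plane → Mat} {G : Plane → Plane} {τ : Plane}

theorem hasTangentialTrace_iff :
    HasTangentialTrace h H G τ ↔ ∀ φ : Plane → ℝ, IsTest (subgraph h) φ → ∀ i : Fin 2,
      ∫ z in halfPlane 0, G z i * φ z =
        (∫ z in halfPlane 0, curlPairing H φ i z) + ∫ x : ℝ, τ i * φ !₂[x, 0] := by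
  refine forall_congr' fun φ => forall_congr' fun hφ => forall_congr' fun i => ?_
  rw [setIntegral_filmSharp_eq fun z hz => by rw [hφ.eq_zero hz, mul_zero]]
  change _ = (∫ z in filmSharp h, curlPairing H φ i z) + _ ↔ _
  rw [setIntegral_filmSharp_eq fun z hz =>
    IsTest.curlPairing_eq_zero (fun hz' => hz (hφ.tsupport_subset hz')) H i]

theorem HasTangentialTrace.mono (hgh : ∀ x, g x ≤ h x) (hH : HasTangentialTrace h H G τ) :
    HasTangentialTrace g H G τ :=
  hasTangentialTrace_iff.2 fun φ hφ =>
    hasTangentialTrace_iff.1 hH φ (hφ.mono (subgraph_mono hgh))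

theorem HasTangentialTrace.isWeakCurl (hH : HasTangentialTrace h H G τ) :
    IsWeakCurl (filmSharp h) H G := by
  intro φ hφ i
  have h_interface (x : ℝ) : φ !₂[x, 0] = 0 := hφ.eq_zero fun hx => lt_irrefl (0 : ℝ) hx.1
  simp only [hH φ (hφ.mono fun _ hz => hz.2) i, h_interface, mul_zero, integral_zero, add_zero]

theorem LocallySquareIntegrable.mono (hgh : ∀ x, g x ≤ h x) (hH : LocallySquareIntegrable h H) :
    LocallySquareIntegrable g H := fun K hK hKg i j =>
  (hH K hK (hKg.trans (subgraph_mono hgh)) i j).mono_measure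
    (Measure.restrict_mono (inter_subset_inter_right K (filmSharp_mono hgh)) le_rfl)

end Trace

theorem memLp_restrict_of_continuous {E : Type*} [NormedAddCommGroup E]
    [SecondCountableTopologyEither Plane E] {f : Plane → E} (hf : Continuous f) {K S : Set Plane}
    (hK : IsCompact K) (hS : S ⊆ K) (p : ENNReal) : MemLp f p (volume.restrict S) := by
  have : IsFiniteMeasure (volume.restrict K) := ⟨by simpa using hK.measure_lt_top⟩
  obtain ⟨C, hC⟩ := hK.exists_bound_of_continuousOn hf.continuousOn
  have h_memLp : MemLp f p (volume.restrict K) :=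
    MemLp.of_bound hf.aestronglyMeasurable C (ae_restrict_of_forall_mem hK.measurableSet hC)
  exact h_memLp.mono_measure (Measure.restrict_mono hS le_rfl)

namespace Admissible

variable {k : ℕ} {ℓ r₀ e₀ : ℝ} {ϱ : Mollifier} {b z : Fin k → Plane} {g h : ℝ → ℝ}
  {H : Plane → Mat}

theorem of_hasTangentialTrace (hℓ : 0 < ℓ) (hh : AdmissibleProfile ℓ h)
    (hz : ∀ i, z i ∈ film ℓ h ∧ Metric.ball (z i) r₀ ⊆ filmSharp h)
    (hH : LocallySquareIntegrable h (periodicExt ℓ H))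
    (h_trace : HasTangentialTrace h (periodicExt ℓ H)
      (regularized ϱ r₀ (dislocationMeasure ℓ b z)) (e₀ • e₁)) :
    Admissible ℓ r₀ e₀ ϱ b h (dislocationMeasure ℓ b z) H := by
  have h_cont := continuous_regularized_dislocationMeasure (r₀ := r₀) ϱ b z hℓ
  obtain ⟨M, hM⟩ := hh.exists_le hℓ
  obtain ⟨K, hK, h_film⟩ := exists_isCompact_film_subset (ℓ := ℓ) hM
  exact ⟨hh, ⟨z, hz, rfl⟩, ⟨hH, _, h_trace.isWeakCurl,
    memLp_restrict_of_continuous h_cont hK h_film 2,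
    fun K hK _ => memLp_restrict_of_continuous h_cont hK Subset.rfl 2⟩, h_trace.isWeakCurl, h_trace⟩

theorem mono (hℓ : 0 < ℓ) (hH : Admissible ℓ r₀ e₀ ϱ b h (dislocationMeasure ℓ b z) H)
    (hg : AdmissibleProfile ℓ g) (hgh : ∀ x, g x ≤ h x)
    (hz : ∀ i, z i ∈ film ℓ g ∧ Metric.ball (z i) r₀ ⊆ filmSharp g) :
    Admissible ℓ r₀ e₀ ϱ b g (dislocationMeasure ℓ b z) H :=
  of_hasTangentialTrace hℓ hg hz
    (LocallySquareIntegrable.mono hgh hH.memHcurl.memLp_loc) (hH.trace_eq.mono hgh)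

end Admissible

/-! ### Flat films -/

/-- The free energy of a film with elastic energy density `W`; the cuts are counted twice. -/
def filmEnergy (ℓ γ : ℝ) (W : Mat → ℝ≥0) (h : ℝ → ℝ) (H : Plane → Mat) : ENNReal :=
  (∫⁻ z in film ℓ h, (W (H z) : ENNReal)) + ENNReal.ofReal γ * μH[1] (graphSet ℓ h) +
    2 * ENNReal.ofReal γ * μH[1] (verticalCracks ℓ h)

/-- The matrix `A` with `A 𝐞₁ = τ` and `A 𝐞₂ = 0`. -/
def layerMatrix (τ : Plane) : Mat := Matrix.of fun i j => if j = 0 then τ i else 0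

/-- The field with tangential part `τ - ∫₀^y g` and no normal part. Its curl is `g`, and its
tangential trace on `{y = 0}` is `τ`. -/
def primitiveField (τ : Plane) (g : Plane → Plane) (z : Plane) : Mat :=
  layerMatrix (τ - ∫ s in (0 : ℝ)..z 1, g !₂[z 0, s])

theorem layerMatrix_apply_zero (τ : Plane) (i : Fin 2) : layerMatrix τ i 0 = τ i := rfl

theorem layerMatrix_apply_one (τ : Plane) (i : Fin 2) : layerMatrix τ i 1 = 0 := rfl

theorem continuous_layerMatrix : Continuous layerMatrix := by
  refine continuous_matrix fun i j => ?_
  fin_cases j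
  · exact PiLp.continuous_apply 2 _ i
  · exact continuous_const

theorem periodicExt_eq_self {ℓ : ℝ} {H : Plane → Mat} (hH : Function.Periodic H (ℓ • e₁)) :
    periodicExt ℓ H = H := by
  funext z
  rw [periodicExt, mul_smul, Int.cast_smul_eq_zsmul]
  exact hH.sub_zsmul_eq _

theorem continuous_primitiveField {τ : Plane} {g : Plane → Plane} (hg : Continuous g) :
    Continuous (primitiveField τ g) := by
  refine continuous_layerMatrix.comp (continuous_const.sub ?_)
  refine intervalIntegral.continuous_parametric_intervalIntegral_of_continuous
    (f := fun (z : Plane) s => g !₂[z 0, s]) (hg.comp ?_) (by fun_prop)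
  refine (PiLp.continuous_toLp 2 _).comp (continuous_pi fun i => ?_)
  fin_cases i
  · exact (PiLp.continuous_apply 2 _ 0).comp continuous_fst
  · exact continuous_snd

theorem periodic_primitiveField {ℓ : ℝ} {τ : Plane} {g : Plane → Plane}
    (hg : Function.Periodic g (ℓ • e₁)) : Function.Periodic (primitiveField τ g) (ℓ • e₁) := by
  intro z
  have h_vertical (s : ℝ) : g !₂[z 0 + ℓ, s] = g !₂[z 0, s] := by
    rw [← hg !₂[z 0, s]]
    congr 1
    ext i
    fin_cases i <;> simp [e₁]
  simp only [primitiveField, add_smul_e₁_zero, add_smul_e₁_one, h_vertical]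

theorem hasDerivAt_primitiveField {g : Plane → Plane} (hg : Continuous g) (τ : Plane) (i : Fin 2)
    (x y : ℝ) : HasDerivAt (fun s : ℝ => primitiveField τ g !₂[x, s] i 0) (-g !₂[x, y] i) y := by
  have h_cont : Continuous fun s : ℝ => g !₂[x, s] := hg.comp (isometry_vertical x).continuous
  have h_deriv := (intervalIntegral.integral_hasDerivAt_right (h_cont.intervalIntegrable 0 y)
    (h_cont.stronglyMeasurableAtFilter _ _) h_cont.continuousAt).const_sub τ
  exact (EuclideanSpace.proj (𝕜 := ℝ) i).hasFDerivAt.comp_hasDerivAt y h_deriv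

theorem hasTangentialTrace_primitiveField {g : Plane → Plane} (hg : Continuous g) (τ : Plane)
    (h : ℝ → ℝ) : HasTangentialTrace h (primitiveField τ g) g τ := by
  refine hasTangentialTrace_iff.2 fun φ hφ i => ?_
  have hA : Continuous fun z => primitiveField τ g z i 0 :=
    (continuous_primitiveField hg).matrix_elem i 0
  have hgi : Continuous fun z => g z i := (PiLp.continuous_apply 2 _ i).comp hg
  have h_int : Integrable fun z => primitiveField τ g z i 0 * fderiv ℝ φ z e₂ :=
    (hA.mul (hφ.continuous_fderiv_apply e₂)).integrable_of_hasCompactSupport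
      (hφ.hasCompactSupport_fderiv_apply e₂).mul_left
  have hg_int : Integrable fun z => g z i * φ z :=
    (hgi.mul hφ.smooth.continuous).integrable_of_hasCompactSupport hφ.hasCompactSupport.mul_left
  have h_green := setIntegral_halfPlane_eq_neg_integral
    (F := fun z => primitiveField τ g z i 0 * φ z) hφ.hasCompactSupport.mul_left
    (h_int.sub hg_int) (fun x y => ((hasDerivAt_primitiveField hg τ i x y).mul
      (hφ.hasDerivAt_vertical x y)).congr_deriv (by simp only [Pi.sub_apply]; ring)) 0
  have h_pairing : curlPairing (primitiveField τ g) φ i =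
      fun z => primitiveField τ g z i 0 * fderiv ℝ φ z e₂ := by
    funext z
    simp only [curlPairing, primitiveField, layerMatrix_apply_one, zero_mul, sub_zero]
  have h_base (x : ℝ) : primitiveField τ g !₂[x, 0] i 0 = τ i := by
    simp [primitiveField, layerMatrix_apply_zero]
  simp only [Pi.sub_apply, h_base] at h_green
  rw [integral_sub h_int.integrableOn hg_int.integrableOn] at h_green
  rw [h_pairing]
  linarith

theorem admissible_primitiveField {k : ℕ} {ℓ r₀ : ℝ} {b z : Fin k → Plane} {h : ℝ → ℝ}
    (hℓ : 0 < ℓ) (e₀ : ℝ) (ϱ : Mollifier) (hh : AdmissibleProfile ℓ h)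
    (hz : ∀ i, z i ∈ film ℓ h ∧ Metric.ball (z i) r₀ ⊆ filmSharp h) :
    Admissible ℓ r₀ e₀ ϱ b h (dislocationMeasure ℓ b z)
      (primitiveField (e₀ • e₁) (regularized ϱ r₀ (dislocationMeasure ℓ b z))) := by
  have h_cont := continuous_regularized_dislocationMeasure (r₀ := r₀) ϱ b z hℓ
  have h_ext := periodicExt_eq_self (periodic_primitiveField (τ := e₀ • e₁)
    (periodic_regularized_dislocationMeasure (ℓ := ℓ) (r₀ := r₀) ϱ b z))
  refine .of_hasTangentialTrace hℓ hh hz ?_ ?_ <;> rw [h_ext]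
  · exact fun K hK _ i j => memLp_restrict_of_continuous
      ((continuous_primitiveField h_cont).matrix_elem i j) hK inter_subset_left 2
  · exact hasTangentialTrace_primitiveField h_cont _ h

theorem filmEnergy_const_lt_top {ℓ γ : ℝ} {W : Mat → ℝ≥0} (hW : Continuous W) (c : ℝ)
    {H : Plane → Mat} (hH : Continuous H) : filmEnergy ℓ γ W (fun _ => c) H < ⊤ := by
  have h_lim (x : ℝ) : Tendsto (fun _ : ℝ => c) (𝓝[≠] x) (𝓝 c) := tendsto_const_nhds
  have h_cracks : verticalCracks ℓ (fun _ : ℝ => c) = ∅ := by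
    ext z
    simp [verticalCracks, lowerLim_eq_of_tendsto (h_lim _)]
  rw [filmEnergy, h_cracks, measure_empty, mul_zero, add_zero,
    hausdorffMeasure_graphSet_of_tendsto h_lim]
  obtain ⟨K, hK, h_film⟩ := exists_isCompact_film_subset (ℓ := ℓ) (h := fun _ => c) fun _ => le_rfl
  have h_memLp : MemLp (fun z => (W (H z) : ℝ)) 1 (volume.restrict (film ℓ fun _ => c)) :=
    memLp_restrict_of_continuous (NNReal.continuous_coe.comp (hW.comp hH)) hK h_film 1
  refine ENNReal.add_lt_top.2 ⟨?_, ENNReal.mul_lt_top ENNReal.ofReal_lt_top ENNReal.ofReal_lt_top⟩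
  simpa [eLpNorm_one_eq_lintegral_enorm] using h_memLp.2

/-! ### Lifting a film onto a flat layer -/

/-- The field `H` moved up by `t`, extended by the constant field `layerMatrix τ` to the layer
`y ≤ t`. -/
def liftedField (t : ℝ) (τ : Plane) (H : Plane → Mat) (z : Plane) : Mat :=
  if t < z 1 then H (z - t • e₂) else layerMatrix τ

section Lift

variable {k : ℕ} {ℓ r₀ e₀ t : ℝ} {ϱ : Mollifier} {b z : Fin k → Plane} {h : ℝ → ℝ}
  {H : Plane → Mat} {G : Plane → Plane} {τ : Plane} {φ : Plane → ℝ}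

theorem liftedField_of_mem {w : Plane} (hw : w ∈ halfPlane t) :
    liftedField t τ H w = H (w - t • e₂) := if_pos hw

theorem liftedField_of_notMem {w : Plane} (hw : w ∉ halfPlane t) :
    liftedField t τ H w = layerMatrix τ := if_neg hw

theorem periodicExt_liftedField (ℓ t : ℝ) (τ : Plane) (H : Plane → Mat) :
    periodicExt ℓ (liftedField t τ H) = liftedField t τ (periodicExt ℓ H) := by
  funext z
  simp only [periodicExt, liftedField, sub_smul_e₁_one, sub_smul_e₂_zero]
  rw [sub_right_comm]

theorem locallySquareIntegrable_liftedField (hH : LocallySquareIntegrable h H) (t : ℝ) (τ : Plane) :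
    LocallySquareIntegrable (fun x => t + h x) (liftedField t τ H) := by
  intro K hK hKh i j
  rw [inter_filmSharp_eq_inter_halfPlane hKh]
  have : IsFiniteMeasure (volume.restrict (K ∩ halfPlane 0)) :=
    ⟨by simpa using (measure_mono inter_subset_left).trans_lt hK.measure_lt_top⟩
  set K' : Set Plane := (· + t • e₂) ⁻¹' K
  have hK' : IsCompact K' := (Homeomorph.addRight (t • e₂)).isCompact_preimage.2 hK
  have hK'h : K' ⊆ subgraph h := fun z hz => by
    have h_lt : (z + t • e₂) 1 < t + h ((z + t • e₂) 0) := hKh hz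
    rw [add_smul_e₂_one, add_smul_e₂_zero, add_comm, add_lt_add_iff_left] at h_lt
    exact h_lt
  have h_upper : MemLp (fun z => H (z - t • e₂) i j) 2 (volume.restrict (K ∩ halfPlane t)) := by
    have h_preimage : K ∩ halfPlane t = (· - t • e₂) ⁻¹' (K' ∩ halfPlane 0) := by
      ext z
      simp [K', halfPlane, e₂]
    rw [h_preimage]
    refine MemLp.comp_measurePreserving (g := fun z => H z i j) ?_
      ((measurePreserving_sub_right volume (t • e₂)).restrict_preimage_emb
        (measurableEmbedding_subRight _) _)
    rw [← inter_filmSharp_eq_inter_halfPlane hK'h]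
    exact hH K' hK' hK'h i j
  classical
  have h_piecewise : (fun z => liftedField t τ H z i j) =
      (halfPlane t).piecewise (fun z => H (z - t • e₂) i j) fun _ => layerMatrix τ i j := by
    funext z
    by_cases hz : z ∈ halfPlane t
    · rw [piecewise_eq_of_mem _ _ _ hz, liftedField_of_mem hz]
    · rw [piecewise_eq_of_notMem _ _ _ hz, liftedField_of_notMem hz]
  rw [h_piecewise]
  refine MemLp.piecewise (measurableSet_halfPlane t) ?_ (memLp_const _)
  rw [Measure.restrict_restrict (measurableSet_halfPlane t)]
  have h_subset : halfPlane t ∩ (K ∩ halfPlane 0) ⊆ K ∩ halfPlane t := fun _ hz => ⟨hz.2.1, hz.1⟩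
  exact h_upper.mono_measure (Measure.restrict_mono h_subset le_rfl)

theorem curlPairing_layerMatrix (τ : Plane) (φ : Plane → ℝ) (i : Fin 2) (z : Plane) :
    curlPairing (fun _ => layerMatrix τ) φ i z = τ i * fderiv ℝ φ z e₂ := by
  rw [curlPairing, layerMatrix_apply_zero, layerMatrix_apply_one, zero_mul, sub_zero]

theorem IsTest.integrable_curlPairing_layerMatrix {U : Set Plane} (hφ : IsTest U φ) (τ : Plane)
    (i : Fin 2) : Integrable (curlPairing (fun _ => layerMatrix τ) φ i) := by
  simp only [funext (curlPairing_layerMatrix τ φ i)]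
  exact ((hφ.continuous_fderiv_apply e₂).integrable_of_hasCompactSupport
    (hφ.hasCompactSupport_fderiv_apply e₂)).const_mul _

theorem IsTest.setIntegral_curlPairing_layerMatrix {U : Set Plane} (hφ : IsTest U φ) (τ : Plane)
    (i : Fin 2) (a : ℝ) :
    ∫ z in halfPlane a, curlPairing (fun _ => layerMatrix τ) φ i z =
      -∫ x : ℝ, τ i * φ !₂[x, a] := by
  simp only [curlPairing_layerMatrix, integral_const_mul, hφ.setIntegral_halfPlane_fderiv, mul_neg]

theorem setIntegral_halfPlane_curlPairing_liftedField (i : Fin 2) :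
    ∫ z in halfPlane t, curlPairing (liftedField t τ H) φ i z =
      ∫ z in halfPlane 0, curlPairing H (fun z => φ (z + t • e₂)) i z := by
  rw [← setIntegral_halfPlane_sub t]
  refine setIntegral_congr_fun (measurableSet_halfPlane t) fun z hz => ?_
  simp only [curlPairing, liftedField_of_mem hz, fderiv_comp_add_right, sub_add_cancel]

theorem IsTest.setIntegral_layer_curlPairing_liftedField {U : Set Plane} (hφ : IsTest U φ)
    (ht : 0 ≤ t) (i : Fin 2) :
    ∫ z in halfPlane 0 \ halfPlane t, curlPairing (liftedField t τ H) φ i z =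
      (-∫ x : ℝ, τ i * φ !₂[x, 0]) + ∫ x : ℝ, τ i * φ !₂[x, t] := by
  have h_subset : halfPlane t ⊆ halfPlane 0 := fun _ hz => ht.trans_lt hz
  rw [setIntegral_congr_fun (g := curlPairing (fun _ => layerMatrix τ) φ i)
      ((measurableSet_halfPlane 0).diff (measurableSet_halfPlane t)) fun z hz => by
        simp only [curlPairing, liftedField_of_notMem hz.2],
    setIntegral_sdiff (measurableSet_halfPlane t)
      (hφ.integrable_curlPairing_layerMatrix τ i).integrableOn h_subset,
    hφ.setIntegral_curlPairing_layerMatrix, hφ.setIntegral_curlPairing_layerMatrix, sub_neg_eq_add]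

theorem hasTangentialTrace_liftedField (hH : HasTangentialTrace h H G τ) (ht : 0 ≤ t)
    (hH_loc : LocallySquareIntegrable h H) (hG : ∀ z, z 1 ≤ 0 → G z = 0) :
    HasTangentialTrace (fun x => t + h x) (liftedField t τ H) (fun z => G (z - t • e₂)) τ := by
  refine hasTangentialTrace_iff.2 fun φ hφ i => ?_
  have h_subset : halfPlane t ⊆ halfPlane 0 := fun _ hz => ht.trans_lt hz
  have h_line (x : ℝ) : (!₂[x, 0] : Plane) + t • e₂ = !₂[x, t] := by
    ext i
    fin_cases i <;> simp [e₂]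
  have h_trace := hasTangentialTrace_iff.1 hH _ hφ.comp_add_smul_e₂ i
  simp only [h_line] at h_trace
  have h_curl : ∫ z in halfPlane 0, G (z - t • e₂) i * φ z =
      ∫ z in halfPlane 0, G z i * φ (z + t • e₂) := by
    rw [setIntegral_eq_of_subset_of_forall_sdiff_eq_zero (measurableSet_halfPlane 0) h_subset,
      ← setIntegral_halfPlane_sub t]
    · simp only [sub_add_cancel]
    · intro z hz
      rw [hG _ (by rw [sub_smul_e₂_one]; exact sub_nonpos.2 (not_lt.1 hz.2)), PiLp.zero_apply,
        zero_mul]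
  have h_split := integral_inter_add_sdiff (measurableSet_halfPlane t)
    (hφ.integrableOn_curlPairing (locallySquareIntegrable_liftedField hH_loc t τ) i)
  rw [inter_eq_self_of_subset_right h_subset, setIntegral_halfPlane_curlPairing_liftedField,
    hφ.setIntegral_layer_curlPairing_liftedField ht] at h_split
  rw [h_curl, h_trace, ← h_split]
  ring

theorem ball_add_smul_e₂_subset (ht : 0 ≤ t) {q : Plane} (hq : Metric.ball q r₀ ⊆ filmSharp h) :
    Metric.ball (q + t • e₂) r₀ ⊆ filmSharp fun x => t + h x := by
  intro w hw
  have h_mem : w - t • e₂ ∈ filmSharp h := hq (by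
    rwa [mem_ball_iff_norm, sub_sub, add_comm (t • e₂), ← mem_ball_iff_norm])
  obtain ⟨h_pos, h_lt⟩ := h_mem
  rw [sub_smul_e₂_one] at h_pos h_lt
  rw [sub_smul_e₂_zero] at h_lt
  exact ⟨by linarith, by linarith⟩

theorem add_smul_e₂_mem_film (ht : 0 ≤ t) {q : Plane} (hq : q ∈ film ℓ h) :
    q + t • e₂ ∈ film ℓ fun x => t + h x := by
  simp only [film, mem_ofPred_eq, add_smul_e₂_zero, add_smul_e₂_one]
  exact ⟨hq.1, by linarith [hq.2.1], by linarith [hq.2.2]⟩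

theorem Admissible.liftedField (hℓ : 0 < ℓ) (hr₀ : 0 < r₀) (ht : 0 ≤ t)
    (hz : ∀ i, z i ∈ film ℓ h ∧ Metric.ball (z i) r₀ ⊆ filmSharp h)
    (hH : Admissible ℓ r₀ e₀ ϱ b h (dislocationMeasure ℓ b z) H) :
    Admissible ℓ r₀ e₀ ϱ b (fun x => t + h x) (dislocationMeasure ℓ b fun i => z i + t • e₂)
      (liftedField t (e₀ • e₁) H) := by
  refine .of_hasTangentialTrace hℓ (hH.profile.const_add ht)
    (fun i => ⟨add_smul_e₂_mem_film ht (hz i).1, ball_add_smul_e₂_subset ht (hz i).2⟩) ?_ ?_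
  · rw [periodicExt_liftedField]
    exact locallySquareIntegrable_liftedField hH.memHcurl.memLp_loc t _
  · rw [periodicExt_liftedField, funext (regularized_dislocationMeasure_add ϱ b z (t • e₂))]
    exact hasTangentialTrace_liftedField hH.trace_eq ht hH.memHcurl.memLp_loc
      fun w => regularized_dislocationMeasure_eq_zero ϱ b z hr₀ fun i => (hz i).2

theorem lowerLim_const_add (hℓ : 0 < ℓ) (hh : AdmissibleProfile ℓ h) (t x : ℝ) :
    lowerLim (fun y => t + h y) x = t + lowerLim h x := by
  obtain ⟨R, hR⟩ := hh.exists_tendsto_right hℓ x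
  obtain ⟨L, hL⟩ := hh.exists_tendsto_left hℓ x
  rw [lowerLim, lowerLim, rightLim_eq_of_tendsto hR, leftLim_eq_of_tendsto hL,
    rightLim_eq_of_tendsto (hR.const_add t), leftLim_eq_of_tendsto (hL.const_add t),
    min_add_add_left]

theorem upperLim_const_add (hℓ : 0 < ℓ) (hh : AdmissibleProfile ℓ h) (t x : ℝ) :
    upperLim (fun y => t + h y) x = t + upperLim h x := by
  obtain ⟨R, hR⟩ := hh.exists_tendsto_right hℓ x
  obtain ⟨L, hL⟩ := hh.exists_tendsto_left hℓ x
  rw [upperLim, upperLim, rightLim_eq_of_tendsto hR, leftLim_eq_of_tendsto hL,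
    rightLim_eq_of_tendsto (hR.const_add t), leftLim_eq_of_tendsto (hL.const_add t),
    max_add_add_left]

theorem hausdorffMeasure_graphSet_const_add (hℓ : 0 < ℓ) (hh : AdmissibleProfile ℓ h) (t : ℝ) :
    μH[1] (graphSet ℓ fun x => t + h x) = μH[1] (graphSet ℓ h) := by
  rw [← (IsometryEquiv.addRight (t • e₂)).hausdorffMeasure_preimage]
  congr 1
  ext z
  simp only [graphSet, mem_preimage, mem_ofPred_eq, IsometryEquiv.addRight_apply, add_smul_e₂_zero,
    add_smul_e₂_one, lowerLim_const_add hℓ hh, upperLim_const_add hℓ hh, add_comm (z 1),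
    add_le_add_iff_left]

theorem hausdorffMeasure_verticalCracks_const_add (hℓ : 0 < ℓ) (hh : AdmissibleProfile ℓ h)
    (t : ℝ) : μH[1] (verticalCracks ℓ fun x => t + h x) = μH[1] (verticalCracks ℓ h) := by
  rw [← (IsometryEquiv.addRight (t • e₂)).hausdorffMeasure_preimage]
  congr 1
  ext z
  simp only [verticalCracks, mem_preimage, mem_ofPred_eq, IsometryEquiv.addRight_apply,
    add_smul_e₂_zero, add_smul_e₂_one, lowerLim_const_add hℓ hh, add_comm (z 1),
    add_le_add_iff_left, add_lt_add_iff_left]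

theorem volume_film_diff_halfPlane_le (ℓ t : ℝ) (h : ℝ → ℝ) :
    volume (film ℓ h \ halfPlane t) ≤ ENNReal.ofReal t * ENNReal.ofReal ℓ := by
  have h_subset : film ℓ h \ halfPlane t ⊆ planeEquiv ⁻¹' (Ico 0 ℓ ×ˢ Icc 0 t) :=
    fun z hz => ⟨hz.1.1, hz.1.2.1.le, not_lt.1 hz.2⟩
  refine (measure_mono h_subset).trans_eq ?_
  rw [measurePreserving_planeEquiv.measure_preimage_equiv, Measure.volume_eq_prod,
    Measure.prod_prod, Real.volume_Ico, Real.volume_Icc, sub_zero, sub_zero, mul_comm]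

theorem lintegral_liftedField_le (hh : Measurable h) (W : Mat → ℝ≥0) :
    ∫⁻ z in film ℓ (fun x => t + h x), (W (liftedField t τ H z) : ENNReal) ≤
      (∫⁻ z in film ℓ h, (W (H z) : ENNReal)) +
        W (layerMatrix τ) * (ENNReal.ofReal t * ENNReal.ofReal ℓ) := by
  have h_film : MeasurableSet (film ℓ fun x => t + h x) := measurableSet_film ℓ (hh.const_add t)
  have h_half := measurableSet_halfPlane t
  rw [← lintegral_inter_add_sdiff _ _ h_half]
  refine add_le_add ?_ ?_
  · have h_subset : film ℓ (fun x => t + h x) ∩ halfPlane t ⊆ (· - t • e₂) ⁻¹' film ℓ h := by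
      rintro z ⟨⟨h_Ico, -, h_lt⟩, h_upper⟩
      simp only [film, mem_preimage, mem_ofPred_eq, sub_smul_e₂_zero, sub_smul_e₂_one]
      exact ⟨h_Ico, sub_pos.2 h_upper, sub_lt_iff_lt_add'.2 h_lt⟩
    rw [← (measurePreserving_sub_right volume (t • e₂)).setLIntegral_comp_preimage_emb
      (measurableEmbedding_subRight _) (fun z => (W (H z) : ENNReal))]
    rw [setLIntegral_congr_fun (h_film.inter h_half) fun z hz => by rw [liftedField_of_mem hz.2]]
    exact lintegral_mono_set h_subset
  · rw [setLIntegral_congr_fun (h_film.diff h_half) fun z hz => by rw [liftedField_of_notMem hz.2],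
      setLIntegral_const]
    gcongr
    exact volume_film_diff_halfPlane_le ℓ t _

theorem filmEnergy_liftedField_le {γ : ℝ} (hℓ : 0 < ℓ) (hh : AdmissibleProfile ℓ h)
    (W : Mat → ℝ≥0) :
    filmEnergy ℓ γ W (fun x => t + h x) (liftedField t τ H) ≤
      filmEnergy ℓ γ W h H + W (layerMatrix τ) * (ENNReal.ofReal t * ENNReal.ofReal ℓ) := by
  rw [filmEnergy, filmEnergy, hausdorffMeasure_graphSet_const_add hℓ hh,
    hausdorffMeasure_verticalCracks_const_add hℓ hh]
  refine (add_le_add_left (add_le_add_left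
    (lintegral_liftedField_le hh.measurable W) _) _).trans_eq ?_
  ring

end Lift

/-! ### Flat minimizers -/

section Flat

variable {k : ℕ} {ℓ r₀ e₀ γ δ x₀ c : ℝ} {ϱ : Mollifier} {b z : Fin k → Plane} {h : ℝ → ℝ}
  {σ : RadonVec} {H : Plane → Mat} {W : Mat → ℝ≥0}

theorem continuous_elasticDensity_symPart (lam mu : ℝ) :
    Continuous fun A : Mat => elasticDensity lam mu (symPart A) := by
  unfold elasticDensity symPart Matrix.trace
  fun_prop

theorem exists_admissible_filmEnergy_lt_top (hℓ : 0 < ℓ) (hW : Continuous W)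
    (hH : Admissible ℓ r₀ e₀ ϱ b h σ H) (hc : ∀ x, Tendsto h (𝓝[≠] x) (𝓝 c)) :
    ∃ g τ K, Admissible ℓ r₀ e₀ ϱ b g τ K ∧ volume (film ℓ g) = volume (film ℓ h) ∧
      filmEnergy ℓ γ W g K < ⊤ := by
  obtain ⟨z, hz, rfl⟩ := hH.dislocation
  have h_le (x : ℝ) : h x ≤ c :=
    le_of_lowerSemicontinuousAt_of_tendsto (hH.profile.lowerSemicontinuous x) (hc x)
  have hc₀ : 0 ≤ c := (hH.profile.nonneg 0).trans (h_le 0)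
  refine ⟨fun _ => c, _, _, admissible_primitiveField hℓ e₀ ϱ
    (.of_lipschitzWith (LipschitzWith.const c) (fun _ => hc₀) fun _ => rfl)
    fun i => ⟨film_mono ℓ h_le (hz i).1, (hz i).2.trans (filmSharp_mono h_le)⟩, ?_, ?_⟩
  · refine (volume_film_congr ℓ hH.profile.measurable measurable_const ?_).symm
    exact hH.profile.ae_eq_of_tendsto hc
  · exact filmEnergy_const_lt_top hW c
      (continuous_primitiveField (continuous_regularized_dislocationMeasure ϱ b z hℓ))

theorem filmEnergy_notchedProfile_add_le (hℓ : 0 < ℓ) (hδ : 0 < δ) (hx₀ : x₀ ∈ Ico 0 ℓ)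
    (hc : ∀ x, Tendsto h (𝓝[≠] x) (𝓝 c)) (h_cut : h x₀ ≤ c - δ) :
    filmEnergy ℓ γ W (notchedProfile ℓ δ x₀ c h) H + ENNReal.ofReal γ * ENNReal.ofReal δ ≤
      filmEnergy ℓ γ W h H := by
  have h_film : film ℓ (notchedProfile ℓ δ x₀ c h) ⊆ film ℓ h := film_mono ℓ notchedProfile_le
  calc _ ≤ (∫⁻ z in film ℓ h, (W (H z) : ENNReal)) +
          ENNReal.ofReal γ * (ENNReal.ofReal ℓ + ENNReal.ofReal δ) +
          2 * ENNReal.ofReal γ * μH[1] (verticalCracks ℓ (notchedProfile ℓ δ x₀ c h)) +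
          ENNReal.ofReal γ * ENNReal.ofReal δ := by
        rw [filmEnergy]
        gcongr
        exact hausdorffMeasure_graphSet_notchedProfile_le hℓ hc
    _ = (∫⁻ z in film ℓ h, (W (H z) : ENNReal)) + ENNReal.ofReal γ * ENNReal.ofReal ℓ +
          2 * ENNReal.ofReal γ * (μH[1] (verticalCracks ℓ (notchedProfile ℓ δ x₀ c h)) +
            ENNReal.ofReal δ) := by ring
    _ ≤ filmEnergy ℓ γ W h H := by
        rw [filmEnergy, hausdorffMeasure_graphSet_of_tendsto hc]
        gcongr
        exact hausdorffMeasure_verticalCracks_notchedProfile_add_le hδ hx₀ hc h_cut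

theorem mem_film_and_ball_subset_notchedProfile {D : ℝ} (hh : AdmissibleProfile ℓ h)
    (hr₀ : 0 < r₀) (hc : ∀ x, h x ≤ c) (hD : 0 ≤ D) (hDr : D ≤ r₀) (h_cut : h x₀ ≤ c - D)
    (hδ : δ ≤ D / 3) {q : Plane} (hq : q ∈ film ℓ h ∧ Metric.ball q r₀ ⊆ filmSharp h) :
    q ∈ film ℓ (notchedProfile ℓ δ x₀ c h) ∧
      Metric.ball q r₀ ⊆ filmSharp (notchedProfile ℓ δ x₀ c h) := by
  have h_ball := ball_subset_filmSharp_notchedProfile hh.periodic hc hD hDr h_cut hδ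
    (hq.1.2.2.le.trans (hc _)) hq.2
  exact ⟨⟨hq.1.1, h_ball (Metric.mem_ball_self hr₀)⟩, h_ball⟩

theorem exists_volume_film_const_add_eq {g : ℝ → ℝ} (hℓ : 0 < ℓ) (hg : AdmissibleProfile ℓ g)
    (hgh : ∀ x, g x ≤ h x) (h_fin : volume (film ℓ h \ film ℓ g) ≠ ⊤) :
    ∃ t, 0 ≤ t ∧ ENNReal.ofReal t * ENNReal.ofReal ℓ = volume (film ℓ h \ film ℓ g) ∧
      volume (film ℓ fun x => t + g x) = volume (film ℓ h) := by
  set v := volume (film ℓ h \ film ℓ g)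
  have ht : 0 ≤ v.toReal / ℓ := by positivity
  have h_layer : ENNReal.ofReal (v.toReal / ℓ) * ENNReal.ofReal ℓ = v := by
    rw [← ENNReal.ofReal_mul ht, div_mul_cancel₀ _ hℓ.ne', ENNReal.ofReal_toReal h_fin]
  refine ⟨v.toReal / ℓ, ht, h_layer, ?_⟩
  rw [volume_film_const_add hg.measurable hg.nonneg ht, h_layer,
    ← measure_sdiff_add_inter (film ℓ h) (measurableSet_film ℓ hg.measurable),
    inter_eq_self_of_subset_right (film_mono ℓ hgh)]

theorem mul_volume_film_diff_notchedProfile_lt {w : ℝ≥0} (hℓ : 0 < ℓ) (hδ : 0 < δ) (hγ : 0 < γ)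
    (hc : ∀ x, h x ≤ c) (hw : 2 * w * δ < γ) :
    w * volume (film ℓ h \ film ℓ (notchedProfile ℓ δ x₀ c h)) <
      ENNReal.ofReal γ * ENNReal.ofReal δ :=
  calc _ ≤ w * ENNReal.ofReal (2 * δ * δ) := by
        gcongr
        exact volume_film_diff_notchedProfile_le hℓ hδ.le hc
    _ = ENNReal.ofReal (2 * w * δ * δ) := by
        rw [← ENNReal.ofReal_coe_nnreal, ← ENNReal.ofReal_mul w.coe_nonneg]
        ring_nf
    _ < ENNReal.ofReal γ * ENNReal.ofReal δ := by
        rw [← ENNReal.ofReal_mul hγ.le, ENNReal.ofReal_lt_ofReal_iff (by positivity)]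
        gcongr

theorem exists_admissible_filmEnergy_lt (hℓ : 0 < ℓ) (hr₀ : 0 < r₀) (hγ : 0 < γ)
    (hH : Admissible ℓ r₀ e₀ ϱ b h σ H) (hc : ∀ x, Tendsto h (𝓝[≠] x) (𝓝 c))
    (hx₀ : x₀ ∈ Ico 0 ℓ) (h_cut : h x₀ < c) (h_fin : filmEnergy ℓ γ W h H ≠ ⊤) :
    ∃ g τ K, Admissible ℓ r₀ e₀ ϱ b g τ K ∧ volume (film ℓ g) = volume (film ℓ h) ∧
      filmEnergy ℓ γ W g K < filmEnergy ℓ γ W h H := by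
  obtain ⟨z, hz, rfl⟩ := hH.dislocation
  have h_le (x : ℝ) : h x ≤ c :=
    le_of_lowerSemicontinuousAt_of_tendsto (hH.profile.lowerSemicontinuous x) (hc x)
  set D := min r₀ (c - h x₀)
  have hD : 0 < D := lt_min hr₀ (sub_pos.2 h_cut)
  have hD_cut : h x₀ ≤ c - D := le_sub_comm.1 (min_le_right _ _)
  set w := W (layerMatrix (e₀ • e₁))
  obtain ⟨δ, hδ, hδ_small⟩ : ∃ δ : ℝ, 0 < δ ∧ δ < min (D / 3) (γ / (2 * w + 1)) :=
    exists_between (by positivity)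
  obtain ⟨hδD, hδw⟩ := lt_min_iff.1 hδ_small
  set g := notchedProfile ℓ δ x₀ c h
  have hg : AdmissibleProfile ℓ g := admissibleProfile_notchedProfile hH.profile hδ.le
    (by linarith [hH.profile.nonneg x₀])
  have hz_g (i : Fin k) := mem_film_and_ball_subset_notchedProfile hH.profile hr₀ h_le hD.le
    (min_le_left _ _) hD_cut hδD.le (hz i)
  have h_area := volume_film_diff_notchedProfile_le (x₀ := x₀) hℓ hδ.le h_le
  have h_energy := filmEnergy_notchedProfile_add_le (γ := γ) (W := W) (H := H) hℓ hδ hx₀ hc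
    (by linarith)
  obtain ⟨t, ht, h_layer, h_volume⟩ := exists_volume_film_const_add_eq hℓ hg notchedProfile_le
    (h_area.trans_lt ENNReal.ofReal_lt_top).ne
  have h_gain := mul_volume_film_diff_notchedProfile_lt (x₀ := x₀) (w := w) hℓ hδ hγ h_le
    (by rw [lt_div_iff₀ (by positivity)] at hδw; linarith)
  refine ⟨_, _, _, (hH.mono hℓ hg notchedProfile_le hz_g).liftedField hℓ hr₀ ht hz_g, h_volume, ?_⟩
  calc _ ≤ filmEnergy ℓ γ W g H + w * volume (film ℓ h \ film ℓ g) :=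
        h_layer ▸ filmEnergy_liftedField_le hℓ hg W
    _ < filmEnergy ℓ γ W g H + ENNReal.ofReal γ * ENNReal.ofReal δ :=
        ENNReal.add_lt_add_left (ne_top_of_le_ne_top h_fin (le_self_add.trans h_energy)) h_gain
    _ ≤ filmEnergy ℓ γ W h H := h_energy

end Flat

end EpitaxialFilm

end

theorem mainTheorem10_general {k : ℕ} {ℓ r₀ e₀ γ : ℝ} (hℓ : 0 < ℓ) (hr₀ : 0 < r₀) (hγ : 0 < γ)
    {W : Mat → NNReal} (hW : Continuous W) {ϱ : Mollifier} {b : Fin k → Plane}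
    {h : ℝ → ℝ} {σ : RadonVec} {H : Plane → Mat}
    (hH : Admissible ℓ r₀ e₀ ϱ b h σ H)
    (hmin : ∀ g τ K, Admissible ℓ r₀ e₀ ϱ b g τ K → volume (film ℓ g) = volume (film ℓ h) →
      filmEnergy ℓ γ W h H ≤ filmEnergy ℓ γ W g K)
    (hflat : ∃ c : ℝ, ∀ x : ℝ, lowerLim h x = c) :
    verticalCracks ℓ h = ∅ := by
  obtain ⟨c, hc⟩ := hflat
  have h_lim := hH.profile.tendsto_of_lowerLim_eq hℓ hc
  by_contra! h_cracks
  obtain ⟨p, hp, h_cut, -⟩ := h_cracks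
  rw [hc] at h_cut
  obtain ⟨g, τ, K, hK, h_volume, h_fin⟩ :=
    exists_admissible_filmEnergy_lt_top (γ := γ) hℓ hW hH h_lim
  obtain ⟨g', τ', K', hK', h_volume', h_lt⟩ := exists_admissible_filmEnergy_lt (W := W) hℓ hr₀ hγ
    hH h_lim hp h_cut ((hmin g τ K hK h_volume).trans_lt h_fin).ne
  exact h_lt.not_ge (hmin g' τ' K' hK' h_volume')

theorem mainTheorem10 {k : ℕ} (ℓ r₀ e₀ lam mu γ d : ℝ)
    (hℓ : 0 < ℓ) (hr₀ : 0 < r₀) (hr₀ℓ : r₀ < ℓ / 2) (he₀ : e₀ ≠ 0)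
    (hmu : 0 < mu) (hlam : 0 < mu + lam) (hγ : 0 < γ) (hd : 0 < d)
    (ϱ : Mollifier) (b : Fin k → Plane)
    (h : ℝ → ℝ) (σ : RadonVec) (H : Plane → Mat)
    (hmin : IsVolumeConstrainedMinimizer ℓ r₀ e₀ lam mu γ d ϱ b h σ H)
    (hflat : ∃ c : ℝ, ∀ x : ℝ, lowerLim h x = c) :
    verticalCracks ℓ h = ∅ :=
  mainTheorem10_general hℓ hr₀ hγ
    (continuous_real_toNNReal.comp (continuous_elasticDensity_symPart lam mu)) hmin.admissible
    (fun g τ K hK hv => hmin.le_energy g τ K hK (hv.trans hmin.volume_eq)) hflat
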